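/- Let $k$ be a field of characteristic $0$. Let $\mathrm{Ass}_n$ be the algebra of formal power series in noncommuting variables $x_1,\dots,x_n$ over $k$, and $\mathfrak{lie}_n\subset \mathrm{Ass}_n$ the completed free Lie algebra (series all of whose homogeneous components are Lie polynomials); for $n=2,3$ write $x,y,z$ for the variables. Put $\mathrm{ch}(x,y)=\ln(e^xe^y)$. Let $\mathfrak{tr}_n=\mathrm{Ass}_n^+/\langle ab-ba\rangle$, where $\mathrm{Ass}_n^+$ is the space of series without constant term, with projection $\mathrm{Tr}:\mathrm{Ass}_n\to\mathfrak{tr}_n$ (zero on constants). Define $\delta:\mathfrak{tr}_2\to\mathfrak{tr}_3$ and $\tilde\delta:\mathfrak{tr}_1\to\mathfrak{tr}_2$ by $(\delta f)(x,y,z)=f(y,z)-f(x+y,z)+f(x,y+z)-f(x,y)$ and $(\tilde\delta f)(x,y)=f(y)-f(\mathrm{ch}(x,y))+f(x)$. Let $\mathfrak{der}^t_n$ be the set of tuples $u=(a_1,\dots,a_n)$ with $a_i\in\mathfrak{lie}_n$ such that the coefficient of $x_i$ in $a_i$ is $0$. Such a $u$ acts on $\mathrm{Ass}_n$ as the continuous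 derivation with $u(x_i)=[x_i,a_i]$, and on $\mathfrak{tr}_n$ by $u\cdot\mathrm{Tr}(a)=\mathrm{Tr}(u(a))$. The group $\mathrm{Dert}_n$ consists of the automorphisms $\exp(u)=\sum_{m\ge0}u^m/m!$, $u\in\mathfrak{der}^t_n$, with composition as product. Writing $a=a_0+\sum_i(\partial_i a)x_i$ for $a\in\mathrm{Ass}_n$, put $\mathrm{div}(u)=\sum_i\mathrm{Tr}(x_i\,\partial_i a_i)$ and $j(\exp u)=\frac{e^u-1}{u}\cdot\mathrm{div}(u)=\sum_{m\ge 0}\frac{1}{(m+1)!}\,u^m\cdot \mathrm{div}(u)$. Let $\mathrm{Sol}(\widehat{KV})$ be the set of $F\in\mathrm{Dert}_2$ with $F(x+y)=\mathrm{ch}(x,y)$ and $j(F)\in\mathrm{im}(\tilde\delta)$. Let $\widehat{\mathfrak{kv}}_2$ be the set of $u\in\mathfrak{der}^t_2$ with $u(x+y)=0$ and $\mathrm{div}(u)\in\ker(\delta)$, and $\widehat{KV}_2=\exp(\widehat{\mathfrak{kv}}_2)$. Let $t=(y,x)$. For $u=(a,b)\in\mathfrak{der}^t_2$ put $$u^{1,2}=(a(x,y),b(x,y),0),\qquad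 u^{2,3}=(0,a(y,z),b(y,z)),$$ $$u^{12,3}=(a(x+y,z),a(x+y,z),b(x+y,z)),\qquad u^{1,23}=(a(x,y+z),b(x,y+z),b(x,y+z)),$$ and for $F=\exp(u)$ put $F^{1,2}=\exp(u^{1,2})$, and so on. The solution of the pentagon equation attached to $F\in\mathrm{Sol}(\widehat{KV})$ is $$\Phi_F=(F^{12,3})^{-1}(F^{1,2})^{-1}F^{2,3}F^{1,23}.$$ **Proposition.** (1) Let $F_1,F_2\in\mathrm{Sol}(\widehat{KV})$. Then $\Phi_{F_1}=\Phi_{F_2}$ if and only if $F_2=F_1\exp(\lambda t)$ for some $\lambda\in k$. (2) For every $\lambda\in k$ one has $\lambda t\in\widehat{\mathfrak{kv}}_2$, and $\exp(\lambda t)$ commutes with every element of $\widehat{KV}_2$. Thus the decomposition of a pentagon solution is unique exactly up to the central one-parameter subgroup generated by $t$. -/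

import Mathlib

/-! ### The algebra `Ass_n` of formal power series in noncommuting variables -/

/-- `Ass_n`, the degree completion of the free associative algebra on `x_1, …, x_n`: a series is
the family of its coefficients, indexed by the words in the letters `Fin n`. -/
def Ass (k : Type*) (n : ℕ) : Type _ := List (Fin n) → k

namespace Ass

section Basic

variable {k : Type*} [Field k] {n m : ℕ}

noncomputable instance : AddCommGroup (Ass k n) := inferInstanceAs (AddCommGroup (List (Fin n) → k))

noncomputable instance : Module k (Ass k n) := inferInstanceAs (Module k (List (Fin n) → k))

@[ext] theorem ext {k : Type*} {a b : Ass k n} (h : ∀ w, a w = b w) : a = b := funext h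

@[simp] theorem zero_apply (w : List (Fin n)) : (0 : Ass k n) w = 0 := rfl

@[simp] theorem add_apply (a b : Ass k n) (w : List (Fin n)) : (a + b) w = a w + b w := rfl

@[simp] theorem sub_apply (a b : Ass k n) (w : List (Fin n)) : (a - b) w = a w - b w := rfl

@[simp] theorem neg_apply (a : Ass k n) (w : List (Fin n)) : (-a) w = -a w := rfl

@[simp] theorem smul_apply (c : k) (a : Ass k n) (w : List (Fin n)) : (c • a) w = c * a w := rfl

theorem sum_apply {ι : Type*} (s : Finset ι) (f : ι → Ass k n) (w : List (Fin n)) :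
    (∑ i ∈ s, f i) w = ∑ i ∈ s, f i w := Finset.sum_apply w s f

/-- The word `w`, as a monomial of `Ass_n`. -/
noncomputable def word (w : List (Fin n)) : Ass k n := fun v => if v = w then 1 else 0

/-- The generator `x_i`. -/
noncomputable def x (i : Fin n) : Ass k n := word [i]

noncomputable instance : One (Ass k n) := ⟨word []⟩

/-- Concatenation product: the coefficient of `w` in `a * b` is the sum over all the ways to cut
`w` into a prefix and a suffix. -/
noncomputable instance : Mul (Ass k n) :=
  ⟨fun a b w => ∑ i ∈ Finset.range (w.length + 1), a (w.take i) * b (w.drop i)⟩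

theorem mul_apply (a b : Ass k n) (w : List (Fin n)) :
    (a * b) w = ∑ i ∈ Finset.range (w.length + 1), a (w.take i) * b (w.drop i) := rfl

theorem one_apply (w : List (Fin n)) : (1 : Ass k n) w = if w = [] then 1 else 0 := rfl

/-- The series of the coefficients of the words that begin with `i`. -/
def shift (i : Fin n) (a : Ass k n) : Ass k n := fun w => a (i :: w)

@[simp] theorem mul_nil (a b : Ass k n) : (a * b) [] = a [] * b [] := by
  simp [mul_apply]

theorem mul_cons (a b : Ass k n) (i : Fin n) (w : List (Fin n)) :
    (a * b) (i :: w) = a [] * b (i :: w) + (shift i a * b) w := by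
  rw [mul_apply, List.length_cons, Finset.sum_range_succ', add_comm]
  rfl

private theorem add_mul' (a b c : Ass k n) : (a + b) * c = a * c + b * c := by
  ext w; simp [mul_apply, add_mul, Finset.sum_add_distrib]

private theorem mul_add' (a b c : Ass k n) : a * (b + c) = a * b + a * c := by
  ext w; simp [mul_apply, mul_add, Finset.sum_add_distrib]

private theorem smul_mul' (r : k) (a b : Ass k n) : (r • a) * b = r • (a * b) := by
  ext w; simp [mul_apply, mul_assoc, Finset.mul_sum]

private theorem mul_smul' (r : k) (a b : Ass k n) : a * (r • b) = r • (a * b) := by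
  ext w; simp [mul_apply, mul_left_comm, Finset.mul_sum]

private theorem zero_mul' (a : Ass k n) : 0 * a = 0 := by
  ext w; simp [mul_apply]

private theorem mul_zero' (a : Ass k n) : a * 0 = 0 := by
  ext w; simp [mul_apply]

private theorem shift_one (i : Fin n) : shift i (1 : Ass k n) = 0 := by
  ext w; simp [shift, one_apply]

private theorem one_mul' (a : Ass k n) : 1 * a = a := by
  ext w
  cases w with
  | nil => simp [one_apply]
  | cons i w => rw [mul_cons, shift_one, zero_mul']; simp [one_apply]

private theorem mul_one' (a : Ass k n) : a * 1 = a := by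
  ext w
  induction w generalizing a with
  | nil => simp [one_apply]
  | cons i w ih => rw [mul_cons, ih]; simp [one_apply, shift]

private theorem shift_mul (i : Fin n) (a b : Ass k n) :
    shift i (a * b) = a [] • shift i b + shift i a * b := by
  ext w; exact mul_cons a b i w

private theorem mul_assoc' (a b c : Ass k n) : a * b * c = a * (b * c) := by
  ext w
  induction w generalizing a with
  | nil => simp [mul_assoc]
  | cons i w ih =>
    rw [mul_cons, mul_cons a, mul_cons b, shift_mul, add_mul', add_apply, ih, smul_mul', mul_nil,
      smul_apply]
    ring

noncomputable instance : Ring (Ass k n) :=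
  { (inferInstance : AddCommGroup (Ass k n)) with
    mul := (· * ·)
    one := 1
    zero_mul := zero_mul'
    mul_zero := mul_zero'
    one_mul := one_mul'
    mul_one := mul_one'
    left_distrib := mul_add'
    right_distrib := add_mul'
    mul_assoc := mul_assoc' }

noncomputable instance : Algebra k (Ass k n) := Algebra.ofModule smul_mul' mul_smul'

/-- The finite set of all words of length at most `N`. -/
noncomputable def words (n N : ℕ) : Finset (List (Fin n)) :=
  (List.finite_length_le (Fin n) N).toFinset

@[simp] theorem mem_words {N : ℕ} {w : List (Fin n)} : w ∈ words n N ↔ w.length ≤ N := by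
  simp [words]

/-- `f = ∑_w f_w w ↦ ∑_w f_w φ(w)`, the continuous linear extension of a map `φ` on words that
does not lower degrees (`φ(w)` has no terms of degree less than the length of `w`); for such `φ`
only words of length at most that of `v` contribute to the coefficient of `v`. -/
noncomputable def extend (φ : List (Fin n) → Ass k m) : Ass k n →ₗ[k] Ass k m where
  toFun f := fun v => ∑ w ∈ words n v.length, f w * φ w v
  map_add' f g := funext fun v => by
    change _ = (∑ w ∈ words n v.length, f w * φ w v) + ∑ w ∈ words n v.length, g w * φ w v
    simp [add_mul, Finset.sum_add_distrib]
  map_smul' c f := funext fun v => by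
    change _ = c * ∑ w ∈ words n v.length, f w * φ w v
    simp [mul_assoc, Finset.mul_sum]

theorem extend_apply (φ : List (Fin n) → Ass k m) (f : Ass k n) (v : List (Fin m)) :
    extend φ f v = ∑ w ∈ words n v.length, f w * φ w v := rfl

/-- `a` has no terms of degree less than `d`. -/
def OrderGE (d : ℕ) (a : Ass k n) : Prop := ∀ w : List (Fin n), w.length < d → a w = 0

theorem OrderGE.mono {d e : ℕ} {a : Ass k n} (h : OrderGE d a) (hed : e ≤ d) : OrderGE e a :=
  fun w hw => h w (by omega)

theorem OrderGE.add {d : ℕ} {a b : Ass k n} (ha : OrderGE d a) (hb : OrderGE d b) :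
    OrderGE d (a + b) := fun w hw => by simp [ha w hw, hb w hw]

theorem OrderGE.mul {d e : ℕ} {a b : Ass k n} (ha : OrderGE d a) (hb : OrderGE e b) :
    OrderGE (d + e) (a * b) := by
  intro w hw
  rw [mul_apply]
  refine Finset.sum_eq_zero fun i hi => ?_
  rw [Finset.mem_range] at hi
  by_cases h : i < d
  · rw [ha _ (by rw [List.length_take]; omega), zero_mul]
  · rw [hb _ (by rw [List.length_drop]; omega), mul_zero]

theorem orderGE_word (w : List (Fin n)) : OrderGE w.length (word w : Ass k n) := by
  intro v hv
  have : v ≠ w := by rintro rfl; omega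
  simp [word, this]

/-! ### Substitution -/

/-- `f ↦ f(b_1, …, b_n)`, the substitution of series `b_i` without constant term for `x_i`. -/
noncomputable def subst (b : Fin n → Ass k m) : Ass k n →ₗ[k] Ass k m :=
  extend fun w => (w.map b).prod

theorem orderGE_prod {b : Fin n → Ass k m} (hb : ∀ i, b i [] = 0) (w : List (Fin n)) :
    OrderGE w.length (w.map b).prod := by
  induction w with
  | nil => intro v hv; simp at hv
  | cons i w ih =>
    rw [List.map_cons, List.prod_cons, List.length_cons, add_comm]
    refine OrderGE.mul (fun v hv => ?_) ih
    have : v = [] := by simpa using hv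
    rw [this, hb]

theorem subst_apply_of_le {b : Fin n → Ass k m} (hb : ∀ i, b i [] = 0) (f : Ass k n)
    (v : List (Fin m)) {N : ℕ} (hN : v.length ≤ N) :
    subst b f v = ∑ w ∈ words n N, f w * (w.map b).prod v := by
  rw [subst, extend_apply]
  refine Finset.sum_subset (fun w hw => ?_) (fun w _ hw => ?_)
  · rw [mem_words] at hw ⊢; omega
  · rw [mem_words, not_le] at hw
    rw [orderGE_prod hb w v hw, mul_zero]

theorem subst_one {b : Fin n → Ass k m} (hb : ∀ i, b i [] = 0) : subst b 1 = 1 := by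
  ext v
  rw [subst_apply_of_le hb 1 v le_rfl, Finset.sum_eq_single []]
  · simp [one_apply]
  · intro w _ hw; simp [one_apply, hw]
  · simp

theorem subst_mul {b : Fin n → Ass k m} (hb : ∀ i, b i [] = 0) (f g : Ass k n) :
    subst b (f * g) = subst b f * subst b g := by
  ext v
  set N := v.length with hNv
  have hr : (subst b f * subst b g) v = ∑ p ∈ words n N ×ˢ words n N,
      f p.1 * g p.2 * ((p.1 ++ p.2).map b).prod v := by
    rw [mul_apply, Finset.sum_congr rfl fun i hi => by
      rw [subst_apply_of_le hb f (v.take i) (N := N) (by rw [List.length_take]; omega),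
        subst_apply_of_le hb g (v.drop i) (N := N) (by rw [List.length_drop]; omega),
        Finset.sum_mul_sum, ← Finset.sum_product'], Finset.sum_comm]
    refine Finset.sum_congr rfl fun p _ => ?_
    rw [List.map_append, List.prod_append, mul_apply, Finset.mul_sum]
    exact Finset.sum_congr rfl fun i _ => by ring
  rw [hr, subst_apply_of_le hb (f * g) v (N := N + N) (by omega)]
  simp_rw [mul_apply, Finset.sum_mul]
  rw [Finset.sum_sigma']
  symm
  refine Finset.sum_of_injOn (fun p => ⟨p.1 ++ p.2, p.1.length⟩) ?_ ?_ ?_ ?_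
  · rintro ⟨p, q⟩ _ ⟨p', q'⟩ _ h
    simp only [Sigma.mk.injEq, heq_eq_eq] at h
    obtain ⟨h1, h2⟩ := List.append_inj h.1 h.2
    rw [h1, h2]
  · rintro ⟨p, q⟩ hp
    simp only [Finset.coe_product, Set.mem_prod, Finset.mem_coe, mem_words] at hp
    simp only [Finset.coe_sigma, Set.mem_sigma_iff, Finset.mem_coe, mem_words, Finset.mem_range,
      List.length_append]
    omega
  · rintro ⟨w, i⟩ hw hni
    simp only [Finset.mem_sigma, mem_words, Finset.mem_range] at hw
    have hlen : N < w.length := by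
      by_contra hle
      refine hni ⟨(w.take i, w.drop i), ?_, ?_⟩
      · simp only [Finset.coe_product, Set.mem_prod, Finset.mem_coe, mem_words, List.length_take,
          List.length_drop]
        omega
      · simp only [List.take_append_drop, List.length_take]
        congr 1
        omega
    rw [orderGE_prod hb w v hlen, mul_zero]
  · rintro ⟨p, q⟩ _
    simp

/-! ### Lie series -/

/-- The homogeneous component of degree `d`. -/
def component (d : ℕ) (a : Ass k n) : Ass k n := fun w => if w.length = d then a w else 0

noncomputable instance : LieRing (Ass k n) := LieRing.ofAssociativeRing

/-- Lie polynomials: the free Lie algebra on `x_1, …, x_n`, as the Lie subalgebra that the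
generators span in the free associative algebra (with bracket `[a, b] = ab - ba`). -/
noncomputable def liePoly (k : Type*) [Field k] (n : ℕ) : LieSubalgebra k (Ass k n) :=
  LieSubalgebra.lieSpan k (Ass k n) (Set.range x)

/-- `lie_n`, the degree completion of the free Lie algebra on `x_1, …, x_n`: the series all of
whose homogeneous components are Lie polynomials. -/
def lie (k : Type*) [Field k] (n : ℕ) : Set (Ass k n) :=
  {a | ∀ d, component d a ∈ liePoly k n}

/-! ### The Campbell–Hausdorff series -/

/-- `∑_j c_j a^j`, for a series `a` without constant term. -/
noncomputable def evalSeries (c : ℕ → k) (a : Ass k n) : Ass k n :=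
  fun w => ∑ j ∈ Finset.range (w.length + 1), c j * (a ^ j) w

/-- `e^a`, for `a` without constant term. -/
noncomputable def exp (a : Ass k n) : Ass k n := evalSeries (fun j => (j.factorial : k)⁻¹) a

/-- `ln b`, for `b` with constant term `1`: `ln (1 - a) = - ∑_{j ≥ 1} a^j / j`
(the term `j = 0` vanishes, since `0⁻¹ = 0`). -/
noncomputable def ln (b : Ass k n) : Ass k n := -evalSeries (fun j => (j : k)⁻¹) (1 - b)

/-- `ch(x, y) = ln (e^x e^y)`. -/
noncomputable def ch (k : Type*) [Field k] : Ass k 2 := ln (exp (x 0) * exp (x 1))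

theorem ch_nil : ch k [] = 0 := by
  simp [ch, ln, evalSeries]

theorem x_nil (i : Fin n) : (x i : Ass k n) [] = 0 := by
  simp [x, word]

/-! ### The space `tr_n` -/

/-- The span of the commutators `ab - ba` and of the constants. -/
noncomputable def trKer (k : Type*) [Field k] (n : ℕ) : Submodule k (Ass k n) :=
  Submodule.span k ({c | ∃ a b : Ass k n, c = a * b - b * a} ∪ {1})

/-- `tr_n = Ass_n^+ / ⟨ab - ba⟩`, written as the quotient of `Ass_n = k ⊕ Ass_n^+` by the
commutators and the constants, so that the trace is defined on all of `Ass_n`. -/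
abbrev Trace (k : Type*) [Field k] (n : ℕ) : Type _ := Ass k n ⧸ trKer k n

/-- The projection `Tr : Ass_n → tr_n`. -/
noncomputable def Tr : Ass k n →ₗ[k] Trace k n := (trKer k n).mkQ

/-- `f ↦ f(b_1, …, b_n)`, as a map `tr_n → tr_m`. -/
noncomputable def Trace.subst (b : Fin n → Ass k m) (hb : ∀ i, b i [] = 0) :
    Trace k n →ₗ[k] Trace k m :=
  (trKer k n).mapQ (trKer k m) (Ass.subst b) (by
    rw [trKer, Submodule.span_le]
    rintro _ (⟨a, c, rfl⟩ | rfl)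
    · refine Submodule.subset_span (Or.inl ⟨Ass.subst b a, Ass.subst b c, ?_⟩)
      rw [map_sub, subst_mul hb, subst_mul hb]
    · exact Submodule.subset_span (Or.inr (subst_one hb)))

/-- `δ : tr_2 → tr_3`, `(δf)(x, y, z) = f(y, z) - f(x + y, z) + f(x, y + z) - f(x, y)`. -/
noncomputable def delta (k : Type*) [Field k] : Trace k 2 →ₗ[k] Trace k 3 :=
  Trace.subst ![x 1, x 2] (by simp [Fin.forall_fin_two, x_nil])
    - Trace.subst ![x 0 + x 1, x 2] (by simp [Fin.forall_fin_two, x_nil])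
    + Trace.subst ![x 0, x 1 + x 2] (by simp [Fin.forall_fin_two, x_nil])
    - Trace.subst ![x 0, x 1] (by simp [Fin.forall_fin_two, x_nil])

/-- `δ̃ : tr_1 → tr_2`, `(δ̃f)(x, y) = f(y) - f(ch(x, y)) + f(x)`. -/
noncomputable def deltaTilde (k : Type*) [Field k] : Trace k 1 →ₗ[k] Trace k 2 :=
  Trace.subst ![x 1] (by simp [x_nil])
    - Trace.subst ![ch k] (by simp [ch_nil])
    + Trace.subst ![x 0] (by simp [x_nil])

/-! ### Tangential derivations -/

/-- `dert_n`: tuples `(a_1, …, a_n)` of Lie series such that the coefficient of `x_i` in `a_i`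
vanishes; such a tuple stands for the derivation with `x_i ↦ [x_i, a_i]`. -/
def dert (k : Type*) [Field k] (n : ℕ) : Set (Fin n → Ass k n) :=
  {u | ∀ i, u i ∈ lie k n ∧ u i [i] = 0}

/-- The value on a word of the derivation with `x_i ↦ [x_i, u_i]`, by the Leibniz rule. -/
noncomputable def derWord (u : Fin n → Ass k n) : List (Fin n) → Ass k n
  | [] => 0
  | i :: w => (x i * u i - u i * x i) * word w + x i * derWord u w

/-- The continuous derivation of `Ass_n` with `x_i ↦ [x_i, u_i]`. -/
noncomputable def der (u : Fin n → Ass k n) : Ass k n →ₗ[k] Ass k n := extend (derWord u)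

theorem orderGE_x (i : Fin n) : OrderGE 1 (x i : Ass k n) := orderGE_word [i]

theorem orderGE_bracket (i : Fin n) (a : Ass k n) : OrderGE 2 (x i * a - a * x i) := by
  have key : x i * a - a * x i = x i * (a - a [] • 1) - (a - a [] • 1) * x i := by
    rw [mul_sub, sub_mul, mul_smul_comm, smul_mul_assoc, mul_one, one_mul]; abel
  have h1 : OrderGE 1 (a - a [] • (1 : Ass k n)) := by
    intro w hw
    have : w = [] := by simpa using hw
    simp [this, one_apply]
  rw [key]
  intro w hw
  rw [sub_apply, (orderGE_x i).mul h1 w hw, h1.mul (orderGE_x i) w hw, sub_zero]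

theorem orderGE_derWord (u : Fin n → Ass k n) (w : List (Fin n)) :
    OrderGE (w.length + 1) (derWord u w) := by
  induction w with
  | nil => intro v _; rfl
  | cons i w ih =>
    refine OrderGE.add ?_ ?_
    · exact ((orderGE_bracket i (u i)).mul (orderGE_word w)).mono (by rw [List.length_cons]; omega)
    · exact ((orderGE_x i).mul ih).mono (by rw [List.length_cons]; omega)

theorem orderGE_der (u : Fin n → Ass k n) {d : ℕ} {f : Ass k n} (hf : OrderGE d f) :
    OrderGE (d + 1) (der u f) := by
  intro v hv
  rw [der, extend_apply]
  refine Finset.sum_eq_zero fun w _ => ?_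
  by_cases h : w.length < d
  · rw [hf w h, zero_mul]
  · rw [orderGE_derWord u w v (by omega), mul_zero]

theorem orderGE_der_pow (u : Fin n → Ass k n) {d : ℕ} {f : Ass k n} (hf : OrderGE d f) (j : ℕ) :
    OrderGE (d + j) ((der u ^ j) f) := by
  induction j with
  | zero => simpa using hf
  | succ j ih => rw [pow_succ', Module.End.mul_apply]; exact orderGE_der u ih

/-- `∑_j c_j u^j(f)` for a derivation `u`; the sum is finite in each degree, since `u` raises
degrees. -/
noncomputable def derSeries (c : ℕ → k) (u : Fin n → Ass k n) : Ass k n →ₗ[k] Ass k n where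
  toFun f := fun w => ∑ j ∈ Finset.range (w.length + 1), c j * (der u ^ j) f w
  map_add' f g := funext fun w => by
    change _ = (∑ j ∈ Finset.range (w.length + 1), c j * (der u ^ j) f w)
      + ∑ j ∈ Finset.range (w.length + 1), c j * (der u ^ j) g w
    simp [mul_add, Finset.sum_add_distrib]
  map_smul' r f := funext fun w => by
    change _ = r * ∑ j ∈ Finset.range (w.length + 1), c j * (der u ^ j) f w
    simp [mul_left_comm, Finset.mul_sum]

theorem derSeries_apply (c : ℕ → k) (u : Fin n → Ass k n) (f : Ass k n) (w : List (Fin n)) :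
    derSeries c u f w = ∑ j ∈ Finset.range (w.length + 1), c j * (der u ^ j) f w := rfl

theorem derSeries_eq (c : ℕ → k) (u : Fin n → Ass k n) (f : Ass k n) (w : List (Fin n)) {N : ℕ}
    (hN : w.length ≤ N) :
    derSeries c u f w = (∑ j ∈ Finset.range (N + 1), c j • (der u ^ j) f) w := by
  rw [sum_apply, derSeries_apply]
  refine Finset.sum_subset (fun j hj => ?_) (fun j _ hj => ?_)
  · rw [Finset.mem_range] at hj ⊢; omega
  · rw [Finset.mem_range, not_lt] at hj
    rw [orderGE_der_pow u (d := 0) (f := f) (fun v hv => by omega) j w (by omega), mul_zero]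

theorem derSeries_mul (b c : ℕ → k) (u : Fin n → Ass k n) (f : Ass k n) :
    derSeries b u (derSeries c u f) = derSeries
      (fun j => ∑ p ∈ Finset.HasAntidiagonal.antidiagonal j, b p.1 * c p.2) u f := by
  ext w
  set N := w.length with hN
  have h1 : ∀ i, (der u ^ i) (derSeries c u f) w
      = ∑ j ∈ Finset.range (N + 1), c j * (der u ^ (i + j)) f w := by
    intro i
    have h2 : OrderGE (N + 1) (derSeries c u f
        - ∑ j ∈ Finset.range (N + 1), c j • (der u ^ j) f) := by
      intro v hv
      rw [sub_apply, derSeries_eq c u f v (N := N) (by omega), sub_self]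
    have h3 := orderGE_der_pow u h2 i w (by omega)
    rw [map_sub, sub_apply, sub_eq_zero] at h3
    rw [h3, map_sum, sum_apply]
    refine Finset.sum_congr rfl fun j _ => ?_
    rw [map_smul, smul_apply, pow_add, Module.End.mul_apply]
  have h0 : ∀ j, N < j → (der u ^ j) f w = 0 := fun j hj =>
    orderGE_der_pow u (d := 0) (f := f) (fun v hv => by omega) j w (by omega)
  rw [derSeries_apply, derSeries_apply, ← hN]
  simp_rw [h1, Finset.mul_sum, Finset.sum_mul]
  rw [← Finset.sum_product', Finset.sum_sigma']
  symm
  refine Finset.sum_of_injOn (fun q => q.2) ?_ ?_ ?_ ?_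
  · rintro ⟨j, p⟩ h ⟨j', p'⟩ h' hp
    simp only [Finset.coe_sigma, Set.mem_sigma_iff, Finset.mem_coe, Finset.HasAntidiagonal.mem_antidiagonal]
      at h h'
    have hpp : p = p' := hp
    subst hpp
    have : j = j' := by omega
    subst this
    rfl
  · rintro ⟨j, p⟩ h
    simp only [Finset.coe_sigma, Set.mem_sigma_iff, Finset.mem_coe, Finset.HasAntidiagonal.mem_antidiagonal,
      Finset.mem_range] at h
    simp only [Finset.coe_product, Set.mem_prod, Finset.mem_coe, Finset.mem_range]
    omega
  · rintro ⟨i, j⟩ _ hni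
    have : N < i + j := by
      by_contra hle
      refine hni ⟨⟨i + j, (i, j)⟩, ?_, rfl⟩
      rw [Finset.mem_coe, Finset.mem_sigma]
      exact ⟨Finset.mem_range.2 (by change i + j < _; omega),
        Finset.HasAntidiagonal.mem_antidiagonal.2 rfl⟩
    simp only [h0 _ this, mul_zero]
  · rintro ⟨j, p⟩ h
    simp only [Finset.mem_sigma, Finset.HasAntidiagonal.mem_antidiagonal] at h
    simp only [← h.2]
    ring


theorem der_neg (u : Fin n → Ass k n) : der (-u) = -der u := by
  have hw : ∀ w, derWord (-u) w = -derWord u w := by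
    intro w
    induction w with
    | nil => simp [derWord]
    | cons i w ih => simp only [derWord, ih, Pi.neg_apply]; noncomm_ring
  refine LinearMap.ext fun f => ?_
  ext v
  simp [der, extend_apply, hw]

theorem derSeries_neg (c : ℕ → k) (u : Fin n → Ass k n) :
    derSeries c (-u) = derSeries (fun j => (-1) ^ j * c j) u := by
  refine LinearMap.ext fun f => ?_
  ext w
  rw [derSeries_apply, derSeries_apply]
  refine Finset.sum_congr rfl fun j _ => ?_
  have : (der (-u) ^ j) f = ((-1 : k) ^ j) • (der u ^ j) f := by
    rw [der_neg]
    have : -der u = (-1 : k) • der u := by simp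
    rw [this, smul_pow, LinearMap.smul_apply]
  rw [this, smul_apply]
  ring

end Basic

section Groups

variable {k : Type*} [Field k] [CharZero k] {n : ℕ}

theorem derSeries_exp_neg (u : Fin n → Ass k n) (f : Ass k n) :
    derSeries (fun j => (j.factorial : k)⁻¹) u
      (derSeries (fun j => (j.factorial : k)⁻¹) (-u) f) = f := by
  rw [derSeries_neg, derSeries_mul]
  have hc : ∀ j, ∑ p ∈ Finset.HasAntidiagonal.antidiagonal j,
      ((p.1.factorial : k)⁻¹ * ((-1) ^ p.2 * (p.2.factorial : k)⁻¹)) = if j = 0 then 1 else 0 := by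
    intro j
    have h := congrArg (PowerSeries.coeff j) (PowerSeries.exp_mul_exp_neg_eq_one (A := k))
    rw [PowerSeries.coeff_mul, PowerSeries.coeff_one] at h
    rw [← h]
    refine Finset.sum_congr rfl fun p _ => ?_
    simp [PowerSeries.evalNegHom, PowerSeries.coeff_rescale, PowerSeries.coeff_exp]
  ext w
  rw [derSeries_apply]
  simp_rw [hc]
  simp

/-- `exp(u) = ∑_j u^j / j!`, the automorphism of `Ass_n` (and of `lie_n ⊆ Ass_n`) attached to a
tangential derivation `u`; its inverse is `exp(-u)`. The group `Dert_n` consists of the `exp(u)`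
with `u ∈ dert_n`; its product is the composition of automorphisms. -/
noncomputable def expAut (u : Fin n → Ass k n) : Ass k n ≃ₗ[k] Ass k n :=
  LinearEquiv.ofLinearMap (derSeries (fun j => (j.factorial : k)⁻¹) u)
    (derSeries (fun j => (j.factorial : k)⁻¹) (-u))
    (LinearMap.ext (derSeries_exp_neg u))
    (LinearMap.ext fun f => by simpa using derSeries_exp_neg (-u) f)

/-! ### Divergence, the cocycle `j`, and the Kashiwara–Vergne problem -/

/-- `∂_i a`, from the decomposition `a = a_0 + ∑_i (∂_i a) x_i`. -/
def partialD (i : Fin n) (a : Ass k n) : Ass k n := fun w => a (w ++ [i])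

/-- `∑_i x_i (∂_i u_i) ∈ Ass_n`. -/
noncomputable def divAss (u : Fin n → Ass k n) : Ass k n := ∑ i, x i * partialD i (u i)

/-- The divergence `div(u) = ∑_i Tr(x_i (∂_i u_i))`. -/
noncomputable def div (u : Fin n → Ass k n) : Trace k n := Tr (divAss u)

/-- The group cocycle `j(exp(u)) = ((e^u - 1) / u) · div(u) = ∑_i u^i · div(u) / (i + 1)!`,
where `u` acts on `tr_n` by `u · Tr(a) = Tr(u(a))`. -/
noncomputable def cocycleJ (u : Fin n → Ass k n) : Trace k n :=
  Tr (derSeries (fun i => ((i + 1).factorial : k)⁻¹) u (divAss u))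

/-- `Sol(HKV)`: the solutions `F = exp(u)`, `u ∈ dert_2`, of the generalized Kashiwara–Vergne
problem `F(x + y) = ch(x, y)`, `j(F) ∈ im δ̃`. The element `F` is recorded by `u = ln F`. -/
def SolHKV (k : Type*) [Field k] [CharZero k] : Set (Fin 2 → Ass k 2) :=
  {u | u ∈ dert k 2 ∧ expAut u (x 0 + x 1) = ch k ∧ cocycleJ u ∈ LinearMap.range (deltaTilde k)}

/-- `hkv_2`: special derivations with divergence in the kernel of `δ`. The group `HKV_2` consists
of the `exp(u)` with `u ∈ hkv_2`. -/
def hkv (k : Type*) [Field k] [CharZero k] : Set (Fin 2 → Ass k 2) :=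
  {u | u ∈ dert k 2 ∧ der u (x 0 + x 1) = 0 ∧ div u ∈ LinearMap.ker (delta k)}

/-- `t = (y, x) ∈ dert_2`. -/
noncomputable def t (k : Type*) [Field k] : Fin 2 → Ass k 2 := ![x 1, x 0]

/-! ### Simplicial and coproduct maps `dert_2 → dert_3` -/

/-- `u^{1,2} = (a(x, y), b(x, y), 0)` for `u = (a, b)`. -/
noncomputable def map_1_2 (u : Fin 2 → Ass k 2) : Fin 3 → Ass k 3 :=
  ![subst ![x 0, x 1] (u 0), subst ![x 0, x 1] (u 1), 0]

/-- `u^{2,3} = (0, a(y, z), b(y, z))`. -/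
noncomputable def map_2_3 (u : Fin 2 → Ass k 2) : Fin 3 → Ass k 3 :=
  ![0, subst ![x 1, x 2] (u 0), subst ![x 1, x 2] (u 1)]

/-- `u^{12,3} = (a(x + y, z), a(x + y, z), b(x + y, z))`. -/
noncomputable def map_12_3 (u : Fin 2 → Ass k 2) : Fin 3 → Ass k 3 :=
  ![subst ![x 0 + x 1, x 2] (u 0), subst ![x 0 + x 1, x 2] (u 0), subst ![x 0 + x 1, x 2] (u 1)]

/-- `u^{1,23} = (a(x, y + z), b(x, y + z), b(x, y + z))`. -/
noncomputable def map_1_23 (u : Fin 2 → Ass k 2) : Fin 3 → Ass k 3 :=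
  ![subst ![x 0, x 1 + x 2] (u 0), subst ![x 0, x 1 + x 2] (u 1), subst ![x 0, x 1 + x 2] (u 1)]

/-- The solution `Φ = (F^{12,3})⁻¹ (F^{1,2})⁻¹ F^{2,3} F^{1,23}` of the pentagon equation attached
to `F = exp(u)`, where `F^{1,2} = exp(u^{1,2})` and so on. -/
noncomputable def pentagonSol (u : Fin 2 → Ass k 2) : Ass k 3 ≃ₗ[k] Ass k 3 :=
  (expAut (map_12_3 u))⁻¹ * (expAut (map_1_2 u))⁻¹ * expAut (map_2_3 u) * expAut (map_1_23 u)

end Groups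

end Ass

/-! Write `F = exp(u)` with `u = (a, b)` and `s = x + y`. The derivation `t` is inner: `[x, y] = [x,
s]` and `[y, x] = [y, s]`, so `exp(c t)` is conjugation `f ↦ e^{-cs} f e^{cs}`. This gives the
second claim at once, because a derivation that kills `s` commutes with the bracket by `s`, and the
divergence of `t` vanishes before the trace is taken.

From `Φ` to `F`: read the part of `Φ(x)` that is of degree one in `x` and begins with `x`. For a
tangential automorphism `x ↦ g⁻¹ x g` this part is `x · g(0, y, z)`. At `x = 0` the automorphisms
`F^{12,3}` and `F^{2,3}` both become `F`, while `F^{1,2}` and `F^{1,23}` act trivially and leave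
only exponentials of linear terms, since a Lie series in one variable is linear. Hence `Φ`
determines the series conjugating `x` to `F⁻¹(x)`, up to left multiplication by a power of `e^s`
(`exists_conj_x_zero`). Setting `z = 0` in `Φ(z)` does the same for `F⁻¹(y)` (`exists_conj_x_one`).
The coefficient of `xy` in `F(x + y)` forces the two exponents to change by the same amount
(`expAut_coeff`), so two solutions with the same `Φ` have inverses that differ by one conjugation by
`e^{μs}`.

From `F` to `Φ`: the maps `F ↦ F^{12,3}` and so on are multiplicative (`expAut_cable_mul`). This is
shown without a formula for the logarithm of a product: the series `f` with `F(xᵢ) = f⁻¹ xᵢ f` is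
unique once its part in `xᵢ` alone is normalized to `1`, so it obeys a cocycle rule
(`conjugator_mul`) that survives cabling. Moreover `t^{1,2}` commutes with `u^{12,3}`, `t^{2,3}`
commutes with `u^{1,23}`, and `t^{1,2} + t^{12,3} = t^{2,3} + t^{1,23}` is the bracket with `x + y +
z`. Finally `Φ` fixes `x + y + z` because `ch` is associative (`pentagonSol_sum`), so it commutes
with that inner automorphism, and the factors coming from `t` cancel (`pentagon_group_identity`). -/

namespace Ass

section

variable {k : Type*} [Field k] {n m p : ℕ}

/-! ### Continuous linear maps -/

theorem orderGE_zero (a : Ass k n) : OrderGE 0 a := fun _ h => absurd h (Nat.not_lt_zero _)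

theorem orderGE_one_iff {a : Ass k n} : OrderGE 1 a ↔ a [] = 0 := by
  refine ⟨fun h => h [] (by simp), fun h w hw => ?_⟩
  have : w = [] := by simpa using hw
  rw [this, h]

/-- Continuity of a linear map for the topology defined by the order of series. -/
def Cts (S : Ass k n →ₗ[k] Ass k m) : Prop :=
  ∀ N, ∃ M, ∀ f, OrderGE M f → OrderGE N (S f)

theorem Cts.comp {S : Ass k m →ₗ[k] Ass k p} {T : Ass k n →ₗ[k] Ass k m} (hS : Cts S)
    (hT : Cts T) : Cts (S ∘ₗ T) := fun N => by
  obtain ⟨M, hM⟩ := hS N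
  obtain ⟨L, hL⟩ := hT M
  exact ⟨L, fun f hf => hM _ (hL f hf)⟩

theorem Cts.add {S T : Ass k n →ₗ[k] Ass k m} (hS : Cts S) (hT : Cts T) : Cts (S + T) :=
  fun N => by
  obtain ⟨M, hM⟩ := hS N
  obtain ⟨L, hL⟩ := hT N
  exact ⟨max M L, fun f hf =>
    (hM f (hf.mono (le_max_left _ _))).add (hL f (hf.mono (le_max_right _ _)))⟩

theorem cts_of_orderGE {S : Ass k n →ₗ[k] Ass k m} (h : ∀ d f, OrderGE d f → OrderGE d (S f)) :
    Cts S := fun N => ⟨N, h N⟩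

theorem cts_id : Cts (LinearMap.id : Ass k n →ₗ[k] Ass k n) := cts_of_orderGE fun _ _ h => h

theorem cts_mulLeft (a : Ass k n) : Cts (LinearMap.mulLeft k a) :=
  cts_of_orderGE fun d f h => by simpa using (orderGE_zero a).mul h

theorem cts_mulRight (a : Ass k n) : Cts (LinearMap.mulRight k a) :=
  cts_of_orderGE fun d f h => by simpa using h.mul (orderGE_zero a)

theorem orderGE_sub_truncation (f : Ass k n) (N : ℕ) :
    OrderGE (N + 1) (f - ∑ w ∈ words n N, f w • word w) := by
  intro v hv
  rw [sub_apply, sum_apply, Finset.sum_eq_single v]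
  · simp [word]
  · intro w _ hw
    simp [word, Ne.symm hw]
  · intro h
    exact absurd (mem_words.2 (by omega)) h

/-- To compare one coefficient, replace the series by a truncation deep enough for both maps; a
truncation is a finite combination of words. -/
theorem Cts.ext_word {S T : Ass k n →ₗ[k] Ass k m} (hS : Cts S) (hT : Cts T)
    (h : ∀ w, S (word w) = T (word w)) : S = T := by
  refine LinearMap.ext fun f => ?_
  ext v
  obtain ⟨M, hM⟩ := hS (v.length + 1)
  obtain ⟨L, hL⟩ := hT (v.length + 1)
  have hf := orderGE_sub_truncation f (max M L)
  have h1 := hM _ (hf.mono (by omega)) v (by omega)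
  have h2 := hL _ (hf.mono (by omega)) v (by omega)
  rw [map_sub, sub_apply, sub_eq_zero] at h1 h2
  rw [h1, h2]
  simp [h]

theorem word_nil : (word [] : Ass k n) = 1 := rfl

theorem x_mul_nil (i : Fin n) (f : Ass k n) : (x i * f : Ass k n) [] = 0 := by simp [x_nil]

theorem shift_x (i j : Fin n) : shift j (x i : Ass k n) = if j = i then 1 else 0 := by
  ext w
  by_cases h : j = i <;> simp [shift, x, word, h, one_apply]

theorem x_mul_cons (i j : Fin n) (f : Ass k n) (w : List (Fin n)) :
    (x i * f : Ass k n) (j :: w) = if j = i then f w else 0 := by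
  rw [mul_cons, shift_x]
  by_cases h : j = i <;> simp [x_nil, h]

theorem word_cons (i : Fin n) (w : List (Fin n)) : (word (i :: w) : Ass k n) = x i * word w := by
  ext v
  cases v with
  | nil => rw [x_mul_nil]; simp [word]
  | cons j v =>
    rw [x_mul_cons]
    by_cases h : j = i <;> simp [word, h]

/-- Induction on words: continuous linear maps agree if they agree on `1` and if agreement
is inherited by multiplication with a generator on the left. -/
theorem Cts.ext_gen {S T : Ass k n →ₗ[k] Ass k m} (hS : Cts S) (hT : Cts T)
    (h1 : S 1 = T 1) (h : ∀ i f, S f = T f → S (x i * f) = T (x i * f)) : S = T :=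
  hS.ext_word hT fun w => by
    induction w with
    | nil => exact h1
    | cons i w ih => rw [word_cons]; exact h i _ ih

theorem cts_extend {φ : List (Fin n) → Ass k m} (hφ : ∀ w, OrderGE w.length (φ w)) :
    Cts (extend φ) := cts_of_orderGE fun d f hf v hv => by
  rw [extend_apply]
  refine Finset.sum_eq_zero fun w _ => ?_
  by_cases h : w.length < d
  · rw [hf w h, zero_mul]
  · rw [hφ w v (by omega), mul_zero]

theorem extend_word {φ : List (Fin n) → Ass k m} (hφ : ∀ w, OrderGE w.length (φ w))
    (w : List (Fin n)) : extend φ (word w) = φ w := by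
  ext v
  rw [extend_apply]
  by_cases h : w.length ≤ v.length
  · rw [Finset.sum_eq_single w]
    · simp [word]
    · intro u _ hu
      simp [word, hu]
    · intro h'
      exact absurd (mem_words.2 h) h'
  · rw [hφ w v (by omega)]
    refine Finset.sum_eq_zero fun u hu => ?_
    rw [mem_words] at hu
    have : u ≠ w := by rintro rfl; exact h hu
    simp [word, this]

/-! ### Substitutions and restrictions to subsets of the variables -/

theorem cts_subst {b : Fin n → Ass k m} (hb : ∀ i, b i [] = 0) : Cts (subst b) :=
  cts_extend (orderGE_prod hb)

theorem subst_x {b : Fin n → Ass k m} (hb : ∀ i, b i [] = 0) (i : Fin n) :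
    subst b (x i) = b i := by
  rw [x, subst, extend_word (orderGE_prod hb)]; simp

theorem subst_id (f : Ass k n) : subst x f = f := by
  have h : subst (x : Fin n → Ass k n) = LinearMap.id :=
    (cts_subst x_nil).ext_gen cts_id (subst_one x_nil) fun i f hf => by
      rw [subst_mul x_nil, subst_x x_nil, hf]; rfl
  rw [h]; rfl

/-- A continuous unital and multiplicative linear map commutes with substitutions. -/
theorem map_subst {G : Ass k m →ₗ[k] Ass k p} (hG : Cts G) (h1 : G 1 = 1)
    (hmul : ∀ f g, G (f * g) = G f * G g) {b : Fin n → Ass k m} (hb : ∀ i, b i [] = 0)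
    (hGb : ∀ i, G (b i) [] = 0) (f : Ass k n) :
    G (subst b f) = subst (fun i => G (b i)) f := by
  have h : G ∘ₗ subst b = subst (fun i => G (b i)) :=
    (hG.comp (cts_subst hb)).ext_gen (cts_subst hGb)
      (by rw [LinearMap.comp_apply, subst_one hb, h1, subst_one hGb]) fun i f hf => by
        rw [LinearMap.comp_apply] at hf ⊢
        rw [subst_mul hb, hmul, hf, subst_mul hGb, subst_x hb, subst_x hGb]
  exact LinearMap.congr_fun h f

theorem subst_nil {b : Fin n → Ass k m} (f : Ass k n) : subst b f [] = f [] := by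
  rw [subst, extend_apply, Finset.sum_eq_single []]
  · simp [one_apply]
  · intro w hw hne
    rw [mem_words] at hw
    exact absurd (List.length_eq_zero_iff.1 (Nat.le_zero.1 hw)) hne
  · simp

/-- The coefficients of the words in the letters `ι i`; for injective `ι` this substitutes `0` for
the other variables. -/
def restr (ι : Fin m → Fin n) : Ass k n →ₗ[k] Ass k m where
  toFun f := fun w => f (w.map ι)
  map_add' _ _ := rfl
  map_smul' _ _ := rfl

theorem restr_apply (ι : Fin m → Fin n) (f : Ass k n) (w : List (Fin m)) :
    restr ι f w = f (w.map ι) := rfl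

theorem restr_mul (ι : Fin m → Fin n) (f g : Ass k n) :
    restr ι (f * g) = restr ι f * restr ι g := by
  ext w
  simp [restr_apply, mul_apply, List.map_take, List.map_drop]

theorem restr_one (ι : Fin m → Fin n) : restr ι (1 : Ass k n) = 1 := by
  ext w
  simp [restr_apply, one_apply]

theorem cts_restr (ι : Fin m → Fin n) : Cts (restr ι : Ass k n →ₗ[k] Ass k m) :=
  cts_of_orderGE fun d f hf w hw => hf _ (by simpa using hw)

theorem restr_x_of_injective {ι : Fin m → Fin n} (hι : Function.Injective ι) (i : Fin m) :
    restr ι (x (ι i) : Ass k n) = x i := by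
  ext w
  have : w.map ι = [ι i] ↔ w = [i] := by
    rw [← (List.map_injective_iff.2 hι).eq_iff (a := w)]; simp
  simp [restr_apply, x, word, this]

theorem restr_x_of_notMem {ι : Fin m → Fin n} {j : Fin n} (hj : ∀ i, ι i ≠ j) :
    restr ι (x j : Ass k n) = 0 := by
  ext w
  have : w.map ι ≠ [j] := by
    intro h
    obtain ⟨i, -, hi⟩ := List.mem_map.1 (h ▸ List.mem_singleton_self j)
    exact hj i hi
  simp [restr_apply, x, word, this]

theorem restr_subst (ι : Fin p → Fin m) {b : Fin n → Ass k m} (hb : ∀ i, b i [] = 0)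
    (f : Ass k n) : restr ι (subst b f) = subst (fun i => restr ι (b i)) f :=
  map_subst (cts_restr ι) (restr_one ι) (restr_mul ι) hb (fun i => hb i) f

/-- `shift` as a linear map. -/
def shiftₗ (i : Fin n) : Ass k n →ₗ[k] Ass k n where
  toFun := shift i
  map_add' _ _ := rfl
  map_smul' _ _ := rfl

theorem shiftₗ_apply (i : Fin n) (f : Ass k n) (w : List (Fin n)) :
    shiftₗ i f w = f (i :: w) := rfl

theorem cts_shiftₗ (i : Fin n) : Cts (shiftₗ i : Ass k n →ₗ[k] Ass k n) := fun N =>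
  ⟨N + 1, fun f hf w hw => hf _ (by simpa using hw)⟩

theorem shiftₗ_mul (i : Fin n) (a b : Ass k n) :
    shiftₗ i (a * b) = a [] • shiftₗ i b + shiftₗ i a * b := by
  ext w; exact mul_cons a b i w

theorem shiftₗ_x (i j : Fin n) : shiftₗ j (x i : Ass k n) = if j = i then 1 else 0 := shift_x i j

/-! ### Derivations -/

theorem cts_der (u : Fin n → Ass k n) : Cts (der u) :=
  cts_extend fun w => (orderGE_derWord u w).mono (by omega)

theorem der_word (u : Fin n → Ass k n) (w : List (Fin n)) : der u (word w) = derWord u w :=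
  extend_word (fun w => (orderGE_derWord u w).mono (by omega)) w

theorem der_one (u : Fin n → Ass k n) : der u 1 = 0 := der_word u []

theorem der_x_mul (u : Fin n → Ass k n) (i : Fin n) (f : Ass k n) :
    der u (x i * f) = (x i * u i - u i * x i) * f + x i * der u f := by
  have h : der u ∘ₗ LinearMap.mulLeft k (x i)
      = LinearMap.mulLeft k (x i * u i - u i * x i) + LinearMap.mulLeft k (x i) ∘ₗ der u :=
    ((cts_der u).comp (cts_mulLeft _)).ext_word
      ((cts_mulLeft _).add ((cts_mulLeft _).comp (cts_der u))) fun w => by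
        simp only [LinearMap.comp_apply, LinearMap.add_apply, LinearMap.mulLeft_apply]
        rw [← word_cons, der_word, der_word]
        rfl
  exact LinearMap.congr_fun h f

theorem der_x (u : Fin n → Ass k n) (i : Fin n) : der u (x i) = x i * u i - u i * x i := by
  simpa [der_one] using der_x_mul u i 1

theorem der_mul (u : Fin n → Ass k n) (f g : Ass k n) :
    der u (f * g) = der u f * g + f * der u g := by
  have h : der u ∘ₗ LinearMap.mulRight k g
      = LinearMap.mulRight k g ∘ₗ der u + LinearMap.mulRight k (der u g) :=
    ((cts_der u).comp (cts_mulRight _)).ext_gen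
      (((cts_mulRight _).comp (cts_der u)).add (cts_mulRight _))
      (by simp [der_one]) fun i f hf => by
        simp only [LinearMap.comp_apply, LinearMap.add_apply, LinearMap.mulRight_apply] at hf ⊢
        rw [mul_assoc, der_x_mul, hf, der_x_mul]
        noncomm_ring
  exact LinearMap.congr_fun h f

/-- A map `u ↦ der u` intertwines with a continuous multiplicative map as soon as it does so on
the generators. -/
theorem map_der {G : Ass k n →ₗ[k] Ass k m} (hG : Cts G) (h1 : G 1 = 1)
    (hmul : ∀ f g, G (f * g) = G f * G g) {u : Fin n → Ass k n} {v : Fin m → Ass k m}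
    (h : ∀ i, G (der u (x i)) = der v (G (x i))) (f : Ass k n) :
    G (der u f) = der v (G f) := by
  have h : G ∘ₗ der u = der v ∘ₗ G :=
    (hG.comp (cts_der u)).ext_gen ((cts_der v).comp hG) (by simp [der_one, h1]) fun i f hf => by
      simp only [LinearMap.comp_apply] at hf ⊢
      rw [der_mul, map_add, hmul, hmul, hmul, der_mul, h, hf]
  exact LinearMap.congr_fun h f

theorem der_comm {u v : Fin n → Ass k n}
    (h : ∀ i, der u (der v (x i)) = der v (der u (x i))) : Commute (der u) (der v) := by
  refine ((cts_der u).comp (cts_der v)).ext_gen ((cts_der v).comp (cts_der u))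
    (by simp [der_one]) fun i f hf => ?_
  change der u (der v f) = der v (der u f) at hf
  change der u (der v (x i * f)) = der v (der u (x i * f))
  simp only [der_mul, map_add, h, hf]
  abel

theorem restr_der {ι : Fin m → Fin n} (hι : Function.Injective ι) (u : Fin n → Ass k n)
    (f : Ass k n) : restr ι (der u f) = der (fun i => restr ι (u (ι i))) (restr ι f) := by
  refine map_der (cts_restr ι) (restr_one ι) (restr_mul ι) (fun j => ?_) f
  rw [der_x, map_sub, restr_mul, restr_mul]
  by_cases hj : ∃ i, ι i = j
  · obtain ⟨i, rfl⟩ := hj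
    rw [restr_x_of_injective hι, der_x]
  · rw [restr_x_of_notMem fun i hi => hj ⟨i, hi⟩]
    simp

theorem der_add (u v : Fin n → Ass k n) : der (u + v) = der u + der v := by
  refine (cts_der _).ext_gen ((cts_der u).add (cts_der v)) (by simp [der_one]) fun i f hf => ?_
  rw [LinearMap.add_apply] at hf ⊢
  rw [der_mul, der_mul, der_mul, hf, der_x, der_x, der_x, Pi.add_apply]
  noncomm_ring

theorem der_zero : der (0 : Fin n → Ass k n) = 0 := by
  simpa using der_add (0 : Fin n → Ass k n) 0

/-- The derivation of the series with one initial letter `j` and no other letter `j`. -/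
theorem restr_shift_der {ι : Fin m → Fin n} (hι : Function.Injective ι) {j : Fin n}
    (hj : ∀ i, ι i ≠ j) (hcov : ∀ l, l = j ∨ ∃ i, ι i = l) {u : Fin n → Ass k n}
    (hu : ∀ i, u i [] = 0) {f : Ass k n} (hf : restr ι f = 0) :
    restr ι (shiftₗ j (der u f)) = restr ι (u j) * restr ι (shiftₗ j f)
      + der (fun i => restr ι (u (ι i))) (restr ι (shiftₗ j f)) := by
  set S : Ass k n →ₗ[k] Ass k m := restr ι ∘ₗ shiftₗ j with hS
  set ub : Fin m → Ass k m := fun i => restr ι (u (ι i)) with hub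
  -- Differentiating an initial letter `x (ι i)` gives the term `-u (ι i) * x (ι i)`, which may
  -- begin with `x j`. `Q` compensates for these terms, so that `key` holds for all series and can
  -- be checked on generators.
  set Q : Ass k n →ₗ[k] Ass k m := ∑ i, LinearMap.mulLeft k (S (u (ι i)) * x i) ∘ₗ
    (restr ι ∘ₗ shiftₗ (ι i)) with hQ
  have hQa : ∀ f, Q f = ∑ i, S (u (ι i)) * x i * restr ι (shiftₗ (ι i) f) := fun f => by
    simp [hQ, mul_assoc]
  have hSc : Cts S := (cts_restr ι).comp (cts_shiftₗ j)
  have hQc : Cts Q := Finset.sum_induction _ Cts (fun _ _ => Cts.add)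
    (cts_of_orderGE fun _ _ _ _ _ => rfl)
    fun i _ => (cts_mulLeft _).comp ((cts_restr ι).comp (cts_shiftₗ _))
  have hSmul : ∀ a b, S (a * b) = a [] • S b + S a * restr ι b := fun a b => by
    simp [hS, shiftₗ_mul, restr_mul]
  have hs1 : ∀ l, shiftₗ l (1 : Ass k n) = 0 := fun l => by ext w; simp [shiftₗ_apply, one_apply]
  have hSx : S (x j) = 1 := by simp [hS, shiftₗ_x, restr_one]
  have hSx' : ∀ i, S (x (ι i)) = 0 := fun i => by simp [hS, shiftₗ_x, (hj i).symm]
  have hdx : ∀ i, S (der u (x (ι i))) = -(S (u (ι i)) * x i) := fun i => by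
    rw [der_x, map_sub, hSmul, hSmul, hSx', hu, x_nil, restr_x_of_injective hι]; simp
  have hdj : S (der u (x j)) = restr ι (u j) := by
    rw [der_x, map_sub, hSmul, hSmul, hSx, hu, x_nil, restr_x_of_notMem hj]; simp
  have hdn : ∀ i, der u (x i) [] = 0 := fun i => by rw [der_x]; simp [hu]
  have key : S ∘ₗ der u + Q = LinearMap.mulLeft k (restr ι (u j)) ∘ₗ S + der ub ∘ₗ S := by
    refine ((hSc.comp (cts_der u)).add hQc).ext_gen
      (((cts_mulLeft _).comp hSc).add ((cts_der _).comp hSc)) ?_ fun l f _ => ?_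
    · have hS1 : S 1 = 0 := by simp [hS, hs1]
      simp [der_one, hS1, hQa, hs1]
    · simp only [LinearMap.add_apply, LinearMap.comp_apply, LinearMap.mulLeft_apply]
      rw [der_mul, map_add, hSmul, hSmul, hSmul, hdn, x_nil, hQa]
      have hsx : ∀ i, shiftₗ i (x l * f) = if i = l then f else 0 := fun i => by
        rw [shiftₗ_mul, x_nil, shiftₗ_x]; split_ifs <;> simp
      simp only [hsx]
      rcases hcov l with rfl | ⟨i, rfl⟩
      · simp [hdj, hSx, hj, restr_der hι, hub]
      · rw [hdx, hSx']
        simp [hι.eq_iff, apply_ite, mul_assoc, Finset.sum_ite_eq']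
  -- `Q` reads only words in the letters `ι i`, and `f` has none of these.
  have hQf : Q f = 0 := by
    rw [hQa]
    refine Finset.sum_eq_zero fun i _ => ?_
    have : restr ι (shiftₗ (ι i) f) = 0 := by
      ext w
      exact congrFun hf (i :: w)
    rw [this, mul_zero]
  have := LinearMap.congr_fun key f
  rw [LinearMap.add_apply, hQf, add_zero] at this
  exact this

end

section

variable {k : Type*} [Field k] {n m p : ℕ}

/-! ### Exponentials of operators that raise the order -/

/-- `D` raises the order of series. -/
def Raises (D : Ass k n →ₗ[k] Ass k n) : Prop := ∀ d f, OrderGE d f → OrderGE (d + 1) (D f)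

theorem Raises.cts {D : Ass k n →ₗ[k] Ass k n} (hD : Raises D) : Cts D :=
  cts_of_orderGE fun d f hf => (hD d f hf).mono (by omega)

theorem Raises.add {D E : Ass k n →ₗ[k] Ass k n} (hD : Raises D) (hE : Raises E) :
    Raises (D + E) := fun d f hf => (hD d f hf).add (hE d f hf)

theorem Raises.neg {D : Ass k n →ₗ[k] Ass k n} (hD : Raises D) : Raises (-D) :=
  fun d f hf w hw => by simp [hD d f hf w hw]

theorem raises_zero : Raises (0 : Ass k n →ₗ[k] Ass k n) := fun _ _ _ _ _ => rfl

theorem raises_der (u : Fin n → Ass k n) : Raises (der u) := fun _ _ hf => orderGE_der u hf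

theorem raises_mulLeft {a : Ass k n} (ha : a [] = 0) : Raises (LinearMap.mulLeft k a) :=
  fun d f hf => by simpa [add_comm] using (orderGE_one_iff.2 ha).mul hf

theorem raises_mulRight {a : Ass k n} (ha : a [] = 0) : Raises (LinearMap.mulRight k a) :=
  fun d f hf => by simpa using hf.mul (orderGE_one_iff.2 ha)

theorem Raises.pow {D : Ass k n →ₗ[k] Ass k n} (hD : Raises D) (j : ℕ) {d : ℕ} {f : Ass k n}
    (hf : OrderGE d f) : OrderGE (d + j) ((D ^ j) f) := by
  induction j with
  | zero => simpa using hf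
  | succ j ih => rw [pow_succ', Module.End.mul_apply]; exact hD _ _ ih

/-- `∑_j D^j / j!`, for an operator `D` that raises the order of series. -/
noncomputable def opExp (D : Ass k n →ₗ[k] Ass k n) : Ass k n →ₗ[k] Ass k n where
  toFun f := fun w => ∑ j ∈ Finset.range (w.length + 1), (j.factorial : k)⁻¹ * (D ^ j) f w
  map_add' f g := funext fun w => by
    change _ = (∑ j ∈ Finset.range (w.length + 1), (j.factorial : k)⁻¹ * (D ^ j) f w)
      + ∑ j ∈ Finset.range (w.length + 1), (j.factorial : k)⁻¹ * (D ^ j) g w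
    simp [mul_add, Finset.sum_add_distrib]
  map_smul' r f := funext fun w => by
    change _ = r * ∑ j ∈ Finset.range (w.length + 1), (j.factorial : k)⁻¹ * (D ^ j) f w
    simp [mul_left_comm, Finset.mul_sum]

theorem opExp_apply (D : Ass k n →ₗ[k] Ass k n) (f : Ass k n) (w : List (Fin n)) :
    opExp D f w = ∑ j ∈ Finset.range (w.length + 1), (j.factorial : k)⁻¹ * (D ^ j) f w := rfl

theorem Raises.opExp_eq {D : Ass k n →ₗ[k] Ass k n} (hD : Raises D) (f : Ass k n)
    (w : List (Fin n)) {N : ℕ} (hN : w.length < N) :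
    opExp D f w = (∑ j ∈ Finset.range N, (j.factorial : k)⁻¹ • (D ^ j) f) w := by
  rw [sum_apply, opExp_apply]
  refine Finset.sum_subset (fun j hj => ?_) (fun j _ hj => ?_)
  · rw [Finset.mem_range] at hj ⊢; omega
  · rw [Finset.mem_range, not_lt] at hj
    rw [hD.pow j (orderGE_zero f) w (by omega), mul_zero]

theorem Raises.opExp_sub {D : Ass k n →ₗ[k] Ass k n} (hD : Raises D) (f : Ass k n) (N : ℕ) :
    OrderGE N (opExp D f - ∑ j ∈ Finset.range N, (j.factorial : k)⁻¹ • (D ^ j) f) :=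
  fun w hw => by rw [sub_apply, hD.opExp_eq f w hw, sub_self]

theorem Raises.orderGE_opExp {D : Ass k n →ₗ[k] Ass k n} (hD : Raises D) {d : ℕ} {f : Ass k n}
    (hf : OrderGE d f) : OrderGE d (opExp D f) := fun w hw => by
  rw [opExp_apply]
  exact Finset.sum_eq_zero fun j _ => by rw [hD.pow j hf w (by omega), mul_zero]

theorem Raises.cts_opExp {D : Ass k n →ₗ[k] Ass k n} (hD : Raises D) : Cts (opExp D) :=
  cts_of_orderGE fun _ _ hf => hD.orderGE_opExp hf

theorem opExp_zero : opExp (0 : Ass k n →ₗ[k] Ass k n) = LinearMap.id := by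
  refine LinearMap.ext fun f => ?_
  ext w
  rw [opExp_apply, Finset.sum_range_succ']
  simp

theorem opExp_of_apply_eq_zero {D : Ass k n →ₗ[k] Ass k n} {f : Ass k n} (h : D f = 0) :
    opExp D f = f := by
  ext w
  rw [opExp_apply, Finset.sum_range_succ']
  simp [pow_succ, h]

theorem opExp_nil (D : Ass k n →ₗ[k] Ass k n) (f : Ass k n) : opExp D f [] = f [] := by
  simp [opExp_apply]

/-- Continuous maps that intertwine two operators intertwine their exponentials. -/
theorem map_opExp_of_pow {S : Ass k n →ₗ[k] Ass k m} (hS : Cts S) {D : Ass k n →ₗ[k] Ass k n}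
    (hD : Raises D) {E : Ass k m →ₗ[k] Ass k m} (hE : Raises E) {f : Ass k n}
    (h : ∀ j, S ((D ^ j) f) = (E ^ j) (S f)) : S (opExp D f) = opExp E (S f) := by
  ext w
  obtain ⟨M, hM⟩ := hS (w.length + 1)
  have h1 := hM _ ((hD.opExp_sub f (max M (w.length + 1))).mono (le_max_left _ _)) w (by omega)
  rw [map_sub, sub_apply, sub_eq_zero] at h1
  rw [h1, hE.opExp_eq (S f) w (N := max M (w.length + 1)) (by omega)]
  simp [h]

theorem map_opExp {S : Ass k n →ₗ[k] Ass k m} (hS : Cts S) {D : Ass k n →ₗ[k] Ass k n}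
    (hD : Raises D) {E : Ass k m →ₗ[k] Ass k m} (hE : Raises E)
    (h : ∀ f, S (D f) = E (S f)) (f : Ass k n) : S (opExp D f) = opExp E (S f) :=
  map_opExp_of_pow hS hD hE fun j => by
    induction j with
    | zero => rfl
    | succ j ih => rw [pow_succ', pow_succ', Module.End.mul_apply, Module.End.mul_apply, h, ih]

theorem opExp_comm {D E : Ass k n →ₗ[k] Ass k n} (hD : Raises D) (hE : Raises E)
    (h : Commute D E) : Commute (opExp D) (opExp E) := by
  have h1 : ∀ f, opExp D (E f) = E (opExp D f) := fun f =>
    (map_opExp hE.cts hD hD (fun f => (LinearMap.congr_fun h.eq f).symm) f).symm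
  exact LinearMap.ext fun f => map_opExp hD.cts_opExp hE hE h1 f

/-- Three operators are allowed because the twisted operator `u + uᵢ` obeys a Leibniz rule with
itself on the first factor and the plain derivation on the second. -/
theorem leibniz_pow {D E F : Ass k n →ₗ[k] Ass k n}
    (h : ∀ f g, D (f * g) = E f * g + f * F g)
    (f g : Ass k n) (r : ℕ) : (D ^ r) (f * g)
      = ∑ q ∈ Finset.HasAntidiagonal.antidiagonal r, r.choose q.1 • ((E ^ q.1) f * (F ^ q.2) g) := by
  induction r with
  | zero => simp
  | succ r ih =>
    rw [Finset.sum_antidiagonal_choose_succ_nsmul (fun i j => (E ^ i) f * (F ^ j) g), pow_succ',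
      Module.End.mul_apply, ih, map_sum, ← Finset.sum_add_distrib]
    refine Finset.sum_congr rfl fun q hq => ?_
    rw [Finset.HasAntidiagonal.mem_antidiagonal] at hq
    rw [map_nsmul, h, ← hq, Nat.choose_symm_add, pow_succ', pow_succ', Module.End.mul_apply,
      Module.End.mul_apply, smul_add, add_comm]

variable [CharZero k]

/-- The binomial identity behind `e^{D+E} = e^D e^E`, truncated: terms with `i + j ≥ N` vanish, so
the triangle of indices can be completed to a square. It serves both `opExp_add` and `opExp_mul`. -/
theorem sum_exp_eq {N : ℕ} {h : ℕ → k} {g : ℕ → ℕ → k} (hg : ∀ i j, N ≤ i + j → g i j = 0)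
    (hh : ∀ r, h r = ∑ q ∈ Finset.HasAntidiagonal.antidiagonal r, r.choose q.1 • g q.1 q.2) :
    ∑ r ∈ Finset.range N, (r.factorial : k)⁻¹ * h r = ∑ i ∈ Finset.range N,
      ∑ j ∈ Finset.range N, (i.factorial : k)⁻¹ * ((j.factorial : k)⁻¹ * g i j) := by
  have h1 : ∀ r, (r.factorial : k)⁻¹ * h r = ∑ i ∈ Finset.range (r + 1),
      (i.factorial : k)⁻¹ * (((r - i).factorial : k)⁻¹ * g i (r - i)) := fun r => by
    rw [hh, Finset.Nat.sum_antidiagonal_eq_sum_range_succ_mk, Finset.mul_sum]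
    refine Finset.sum_congr rfl fun i hi => ?_
    have hi : i ≤ r := Nat.lt_succ_iff.1 (Finset.mem_range.1 hi)
    have e1 : (r.factorial : k) ≠ 0 := Nat.cast_ne_zero.2 r.factorial_ne_zero
    have e2 : (i.factorial : k) ≠ 0 := Nat.cast_ne_zero.2 i.factorial_ne_zero
    have e3 : ((r - i).factorial : k) ≠ 0 := Nat.cast_ne_zero.2 (r - i).factorial_ne_zero
    rw [nsmul_eq_mul, Nat.cast_choose k hi]
    field_simp
  simp_rw [h1]
  rw [Finset.sum_range_diag_flip N fun i j =>
    (i.factorial : k)⁻¹ * ((j.factorial : k)⁻¹ * g i j)]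
  refine Finset.sum_congr rfl fun i _ => Finset.sum_subset (fun j hj => ?_) fun j _ hj => ?_
  · rw [Finset.mem_range] at hj ⊢; omega
  · rw [Finset.mem_range, not_lt] at hj
    rw [hg i j (by omega), mul_zero, mul_zero]

theorem opExp_add {D E : Ass k n →ₗ[k] Ass k n} (hD : Raises D) (hE : Raises E)
    (h : Commute D E) (f : Ass k n) : opExp (D + E) f = opExp D (opExp E f) := by
  ext w
  have h2 : ∀ i, (D ^ i) (opExp E f) w = ∑ j ∈ Finset.range (w.length + 1),
      (j.factorial : k)⁻¹ * (D ^ i) ((E ^ j) f) w := fun i => by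
    have := (hD.pow i (hE.opExp_sub f (w.length + 1))) w (by omega)
    rw [map_sub, sub_apply, sub_eq_zero] at this
    rw [this, map_sum, sum_apply]
    simp
  rw [opExp_apply, opExp_apply]
  simp_rw [h2, Finset.mul_sum]
  refine sum_exp_eq (g := fun i j => (D ^ i) ((E ^ j) f) w) (fun i j hij => ?_) fun r => ?_
  · exact hD.pow i (hE.pow j (orderGE_zero f)) w (by omega)
  · rw [h.add_pow', LinearMap.sum_apply, sum_apply]
    refine Finset.sum_congr rfl fun q _ => ?_
    rw [← Nat.cast_smul_eq_nsmul k, LinearMap.smul_apply, smul_apply, nsmul_eq_mul]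
    rfl

theorem opExp_neg_apply {D : Ass k n →ₗ[k] Ass k n} (hD : Raises D) (f : Ass k n) :
    opExp D (opExp (-D) f) = f := by
  rw [← opExp_add hD hD.neg (Commute.neg_right (Commute.refl D)), add_neg_cancel, opExp_zero]
  rfl

theorem opExp_apply_neg {D : Ass k n →ₗ[k] Ass k n} (hD : Raises D) (f : Ass k n) :
    opExp (-D) (opExp D f) = f := by
  simpa using opExp_neg_apply hD.neg f

/-- With `D = E = F` a derivation this makes `exp(u)` multiplicative; with `E` or `F` zero it
exponentiates right or left multiplications; with `D = E` a twisted operator it splits off the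
conjugating series. -/
theorem opExp_mul {D E F : Ass k n →ₗ[k] Ass k n} (hE : Raises E)
    (hF : Raises F) (h : ∀ f g, D (f * g) = E f * g + f * F g) (f g : Ass k n) :
    opExp D (f * g) = opExp E f * opExp F g := by
  ext w
  set N := w.length + 1 with hN
  set a := ∑ j ∈ Finset.range N, (j.factorial : k)⁻¹ • (E ^ j) f with ha
  set b := ∑ j ∈ Finset.range N, (j.factorial : k)⁻¹ • (F ^ j) g with hb
  have h1 : (opExp E f * opExp F g) w = (a * b) w := by
    have e : opExp E f * opExp F g - a * b = (opExp E f - a) * opExp F g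
        + a * (opExp F g - b) := by noncomm_ring
    have := (((hE.opExp_sub f N).mul (orderGE_zero (opExp F g))).add
      (((orderGE_zero a).mul (hF.opExp_sub g N)).mono (by omega))) w (by omega)
    rw [← e, sub_apply, sub_eq_zero] at this
    exact this
  rw [h1, ha, hb, Finset.sum_mul_sum, sum_apply, opExp_apply]
  simp_rw [sum_apply, smul_mul_smul_comm, smul_apply, mul_assoc]
  refine sum_exp_eq (g := fun i j => ((E ^ i) f * (F ^ j) g : Ass k n) w) (fun i j hij => ?_)
    fun r => ?_
  · exact ((hE.pow i (orderGE_zero f)).mul (hF.pow j (orderGE_zero g))) w (by omega)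
  · rw [leibniz_pow h, sum_apply]
    refine Finset.sum_congr rfl fun q _ => ?_
    rw [← Nat.cast_smul_eq_nsmul k, smul_apply, nsmul_eq_mul]

end

/-! ### Exponentials of series and tangential automorphisms -/

section Exponential

variable {k : Type*} [Field k] {n m : ℕ}

theorem exp_eq_opExp_mulLeft (a : Ass k n) : exp a = opExp (LinearMap.mulLeft k a) 1 := by
  ext w
  rw [opExp_apply]
  simp only [LinearMap.pow_mulLeft, LinearMap.mulLeft_apply, mul_one]
  rfl

theorem exp_eq_opExp_mulRight (a : Ass k n) : exp a = opExp (LinearMap.mulRight k a) 1 := by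
  ext w
  rw [opExp_apply]
  simp only [LinearMap.pow_mulRight, LinearMap.mulRight_apply, one_mul]
  rfl

theorem exp_zero : exp (0 : Ass k n) = 1 := by
  rw [exp_eq_opExp_mulLeft, LinearMap.mulLeft_zero_eq_zero, opExp_zero]
  rfl

variable [CharZero k]

theorem opExp_mulLeft {a : Ass k n} (ha : a [] = 0) (f : Ass k n) :
    opExp (LinearMap.mulLeft k a) f = exp a * f := by
  have := opExp_mul (raises_mulLeft ha) raises_zero (D := LinearMap.mulLeft k a)
    (fun f g => by simp [mul_assoc]) 1 f
  rwa [one_mul, opExp_zero, ← exp_eq_opExp_mulLeft] at this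

theorem opExp_mulRight {a : Ass k n} (ha : a [] = 0) (f : Ass k n) :
    opExp (LinearMap.mulRight k a) f = f * exp a := by
  have := opExp_mul raises_zero (raises_mulRight ha) (D := LinearMap.mulRight k a)
    (fun f g => by simp [mul_assoc]) f 1
  rwa [mul_one, opExp_zero, ← exp_eq_opExp_mulRight] at this

theorem exp_add_of_commute {a b : Ass k n} (ha : a [] = 0) (hb : b [] = 0) (h : Commute a b) :
    exp (a + b) = exp a * exp b := by
  have hc : Commute (LinearMap.mulLeft k a) (LinearMap.mulLeft k b) :=
    LinearMap.ext fun f => by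
      change a * (b * f) = b * (a * f)
      rw [← mul_assoc, h.eq, mul_assoc]
  have := opExp_add (raises_mulLeft ha) (raises_mulLeft hb) hc 1
  rw [opExp_mulLeft hb, opExp_mulLeft ha, mul_one] at this
  rw [← this, exp_eq_opExp_mulLeft]
  congr 2
  ext f : 1
  simp [add_mul]

theorem exp_commute {a b : Ass k n} (ha : a [] = 0) (h : Commute a b) : Commute (exp a) b := by
  change exp a * b = b * exp a
  rw [← opExp_mulLeft ha, ← opExp_mulRight ha]
  ext w
  simp only [opExp_apply, LinearMap.pow_mulLeft, LinearMap.mulLeft_apply, LinearMap.pow_mulRight,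
    LinearMap.mulRight_apply, (h.pow_left _).eq]

theorem exp_mul_exp_neg {a : Ass k n} (ha : a [] = 0) : exp a * exp (-a) = 1 := by
  rw [← exp_add_of_commute ha (by simp [ha]) (Commute.neg_right (Commute.refl a)),
    add_neg_cancel, exp_zero]

theorem isUnit_exp {a : Ass k n} (ha : a [] = 0) : IsUnit (exp a) :=
  ⟨⟨exp a, exp (-a), exp_mul_exp_neg ha, by
    simpa using exp_mul_exp_neg (a := -a) (by simp [ha])⟩, rfl⟩

end Exponential

/-! ### The conjugating series of a tangential automorphism -/

section Tangential

variable {k : Type*} [Field k] {n m : ℕ}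

/-- The operator `u + uᵢ` on series, whose exponential keeps track of the conjugating series in
`exp(u)(xᵢ) = f⁻¹ xᵢ f`. -/
noncomputable def twist (u : Fin n → Ass k n) (i : Fin n) : Ass k n →ₗ[k] Ass k n :=
  LinearMap.mulLeft k (u i) + der u

theorem raises_twist {u : Fin n → Ass k n} {i : Fin n} (hu : u i [] = 0) : Raises (twist u i) :=
  (raises_mulLeft hu).add (raises_der u)

/-- Since `uᵢ xᵢ + [xᵢ, uᵢ] = xᵢ uᵢ`, the operator `u + uᵢ` commutes with left multiplication by
`xᵢ`. -/
theorem opExp_twist_x_mul {u : Fin n → Ass k n} {i : Fin n} (hu : u i [] = 0) (f : Ass k n) :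
    opExp (twist u i) (x i * f) = x i * opExp (twist u i) f :=
  (map_opExp (S := LinearMap.mulLeft k (x i)) (cts_mulLeft _) (raises_twist hu) (raises_twist hu)
    (fun f => by simp only [twist, LinearMap.add_apply, LinearMap.mulLeft_apply, der_x_mul]
                 noncomm_ring) f).symm

variable [CharZero k]

theorem expAut_apply (u : Fin n → Ass k n) (f : Ass k n) : expAut u f = opExp (der u) f := rfl

theorem expAut_neg_apply (u : Fin n → Ass k n) (f : Ass k n) :
    expAut (-u) (expAut u f) = f := (expAut u).symm_apply_apply f

theorem expAut_apply_neg (u : Fin n → Ass k n) (f : Ass k n) :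
    expAut u (expAut (-u) f) = f := (expAut u).apply_symm_apply f

theorem expAut_mul (u : Fin n → Ass k n) (f g : Ass k n) :
    expAut u (f * g) = expAut u f * expAut u g :=
  opExp_mul (raises_der u) (raises_der u) (der_mul u) f g

theorem expAut_of_der_eq_zero {u : Fin n → Ass k n} {f : Ass k n} (h : der u f = 0) :
    expAut u f = f := opExp_of_apply_eq_zero h

theorem expAut_one (u : Fin n → Ass k n) : expAut u 1 = 1 := expAut_of_der_eq_zero (der_one u)

theorem isUnit_expAut (u : Fin n → Ass k n) {f : Ass k n} (hf : IsUnit f) :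
    IsUnit (expAut u f) := by
  obtain ⟨⟨a, b, hab, hba⟩, rfl⟩ := hf
  refine ⟨⟨expAut u a, expAut u b, ?_, ?_⟩, rfl⟩
  · rw [← expAut_mul, hab, expAut_one]
  · rw [← expAut_mul, hba, expAut_one]

theorem cts_expAut (u : Fin n → Ass k n) : Cts (expAut u : Ass k n →ₗ[k] Ass k n) :=
  (raises_der u).cts_opExp

theorem expAut_nil (u : Fin n → Ass k n) (f : Ass k n) : expAut u f [] = f [] := opExp_nil _ f

theorem expAut_zero (f : Ass k n) : expAut 0 f = f :=
  expAut_of_der_eq_zero (by rw [der_zero]; rfl)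

/-- The series `f` with `exp(u)(xᵢ) = f⁻¹ xᵢ f`. -/
noncomputable def conjugator (u : Fin n → Ass k n) (i : Fin n) : Ass k n := opExp (twist u i) 1

theorem opExp_twist {u : Fin n → Ass k n} {i : Fin n} (hu : u i [] = 0) (f : Ass k n) :
    opExp (twist u i) f = conjugator u i * expAut u f := by
  have := opExp_mul (raises_twist hu) (raises_der u) (D := twist u i)
    (fun f g => by simp only [twist, LinearMap.add_apply, LinearMap.mulLeft_apply, der_mul]
                   noncomm_ring) 1 f
  rwa [one_mul] at this

theorem x_mul_conjugator {u : Fin n → Ass k n} {i : Fin n} (hu : u i [] = 0) :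
    x i * conjugator u i = conjugator u i * expAut u (x i) := by
  rw [← opExp_twist hu, conjugator, ← opExp_twist_x_mul hu, mul_one]

/-- The exponential of `u + uᵢ` is `exp(u)` followed by left multiplication by the conjugator. Being
bijective, it yields a right inverse by surjectivity, and injectivity makes that inverse two-sided.
-/
theorem isUnit_conjugator {u : Fin n → Ass k n} {i : Fin n} (hu : u i [] = 0) :
    IsUnit (conjugator u i) := by
  have hT := raises_twist hu
  set f := conjugator u i with hf
  obtain ⟨h, hh⟩ : ∃ h, opExp (twist u i) h = 1 := ⟨_, opExp_neg_apply hT 1⟩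
  rw [opExp_twist hu] at hh
  have hinj : ∀ g, f * g = 0 → g = 0 := fun g hg => by
    have h1 := opExp_apply_neg hT (expAut (-u) g)
    rw [opExp_twist hu, expAut_apply_neg, ← hf, hg, map_zero] at h1
    rw [← expAut_apply_neg u g, ← h1, map_zero]
  refine ⟨⟨f, expAut u h, hh, ?_⟩, rfl⟩
  rw [← sub_eq_zero]
  apply hinj
  rw [mul_sub, ← mul_assoc, ← hf] at *
  rw [hh]; simp

theorem opExp_twist_exp_mul {u : Fin n → Ass k n} {i : Fin n} (hu : u i [] = 0) (c : k)
    (f : Ass k n) :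
    opExp (twist u i) (exp (c • x i) * f) = exp (c • x i) * opExp (twist u i) f := by
  have hc : (c • x i : Ass k n) [] = 0 := by simp [x_nil]
  rw [← opExp_mulLeft hc, ← opExp_mulLeft hc]
  exact map_opExp (raises_twist hu).cts_opExp (raises_mulLeft hc) (raises_mulLeft hc)
    (fun f => by simp [opExp_twist_x_mul hu]) f

theorem restr_expAut {ι : Fin m → Fin n} (hι : Function.Injective ι) (u : Fin n → Ass k n)
    (f : Ass k n) : restr ι (expAut u f) = expAut (fun i => restr ι (u (ι i))) (restr ι f) :=
  map_opExp (cts_restr ι) (raises_der u) (raises_der _) (restr_der hι u) f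

/-- The rule `restr_shift_der` needs every word of the series to contain `x j`. Such series are
stable under `u`, so the rule can be iterated and exponentiated. -/
theorem restr_shift_expAut {ι : Fin m → Fin n} (hι : Function.Injective ι) {j : Fin n}
    (hj : ∀ i, ι i ≠ j) (hcov : ∀ l, l = j ∨ ∃ i, ι i = l) {u : Fin n → Ass k n}
    (hu : ∀ i, u i [] = 0) {f : Ass k n} (hf : restr ι f = 0) :
    restr ι (shiftₗ j (expAut u f)) = opExp (LinearMap.mulLeft k (restr ι (u j))
      + der fun i => restr ι (u (ι i))) (restr ι (shiftₗ j f)) := by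
  refine map_opExp_of_pow (S := restr ι ∘ₗ shiftₗ j) ((cts_restr ι).comp (cts_shiftₗ j))
    (raises_der u) ((raises_mulLeft (a := restr ι (u j)) (hu j)).add (raises_der _)) fun r => ?_
  have hr : ∀ r, restr ι ((der u ^ r) f) = 0 := fun r => by
    induction r with
    | zero => exact hf
    | succ r ih => rw [pow_succ', Module.End.mul_apply, restr_der hι, ih, map_zero]
  induction r with
  | zero => rfl
  | succ r ih =>
    rw [pow_succ', pow_succ', Module.End.mul_apply, Module.End.mul_apply, ← ih]
    exact restr_shift_der hι hj hcov hu (hr r)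

end Tangential

/-! ### Lie series in one variable -/

section Lie

variable {k : Type*} [Field k] {n m : ℕ}

/-- Reversing the order of the cuts of `xᵢ^d` exchanges prefix and suffix. -/
theorem mul_replicate (a b : Ass k n) (i : Fin n) (d : ℕ) :
    (a * b) (List.replicate d i) = (b * a) (List.replicate d i) := by
  rw [mul_apply, mul_apply, List.length_replicate, ← Finset.sum_range_reflect]
  refine Finset.sum_congr rfl fun j hj => ?_
  rw [Finset.mem_range] at hj
  simp only [List.take_replicate, List.drop_replicate]
  rw [mul_comm]
  congr 3 <;> omega

/-- Lie polynomials in one variable are linear. -/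
theorem liePoly_replicate {a : Ass k n} (ha : a ∈ liePoly k n) (i : Fin n) {d : ℕ} (hd : d ≠ 1) :
    a (List.replicate d i) = 0 := by
  let L : LieSubalgebra k (Ass k n) :=
    { carrier := {a | a (List.replicate d i) = 0}
      add_mem' := fun {a b} ha hb => by
        simp only [Set.mem_ofPred_eq] at ha hb ⊢; simp [ha, hb]
      zero_mem' := rfl
      smul_mem' := fun c a ha => by simp only [Set.mem_ofPred_eq] at ha ⊢; simp [ha]
      lie_mem' := fun {a b} _ _ => by
        change (a * b - b * a) (List.replicate d i) = 0
        rw [sub_apply, mul_replicate, sub_self] }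
  have hL : liePoly k n ≤ L := by
    refine LieSubalgebra.lieSpan_le.2 ?_
    rintro _ ⟨j, rfl⟩
    change x j (List.replicate d i) = 0
    have : List.replicate d i ≠ [j] := fun h => hd (by simpa using congrArg List.length h)
    simp [x, word, this]
  exact hL ha

theorem lie_replicate {a : Ass k n} (ha : a ∈ lie k n) (i : Fin n) {d : ℕ} (hd : d ≠ 1) :
    a (List.replicate d i) = 0 := by
  simpa [component] using liePoly_replicate (ha d) i hd

theorem lie_nil {a : Ass k n} (ha : a ∈ lie k n) (hn : Fin n) : a [] = 0 :=
  lie_replicate ha hn (d := 0) (by simp)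

/-- A word containing another letter is sent to `0`, and of the powers of `xᵢ` a Lie series contains
only the first. -/
theorem subst_single {a : Ass k n} (ha : a ∈ lie k n) (i : Fin n) {q : Ass k m} (hq : q [] = 0) :
    subst (Pi.single i q) a = a [i] • q := by
  have hb : ∀ j, (Pi.single i q : Fin n → Ass k m) j [] = 0 := fun j => by
    by_cases h : j = i
    · subst h; simpa using hq
    · simp [Pi.single_eq_of_ne h]
  ext v
  rw [subst_apply_of_le hb a v (Nat.le_succ _), Finset.sum_eq_single [i]]
  · simp
  · intro w _ hw
    by_cases h : ∀ j ∈ w, j = i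
    · have hr := List.eq_replicate_of_mem h
      have hl : w.length ≠ 1 := fun hl => hw (by rw [hr, hl]; rfl)
      rw [hr, lie_replicate ha i hl, zero_mul]
    · push Not at h
      obtain ⟨j, hj, hji⟩ := h
      have : (w.map (Pi.single i q : Fin n → Ass k m)).prod = 0 :=
        List.prod_eq_zero (List.mem_map.2 ⟨j, hj, by simp [Pi.single_eq_of_ne hji]⟩)
      rw [this, zero_apply, mul_zero]
  · simp

theorem dert_nil {u : Fin n → Ass k n} (hu : u ∈ dert k n) (i : Fin n) : u i [] = 0 :=
  lie_nil (hu i).1 i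

end Lie

section

/-! ### Recovering `F` from the solution of the pentagon equation -/

variable {k : Type*} [Field k] {n m : ℕ}

theorem subst_zero_left {a : Ass k 2} (ha : a ∈ lie k 2) {q : Ass k m} (hq : q [] = 0) :
    subst ![0, q] a = a [1] • q := by
  rw [← subst_single ha 1 hq]
  congr 2
  funext i; fin_cases i <;> simp

theorem subst_zero_right {a : Ass k 2} (ha : a ∈ lie k 2) {q : Ass k m} (hq : q [] = 0) :
    subst ![q, 0] a = a [0] • q := by
  rw [← subst_single ha 0 hq]
  congr 2
  funext i; fin_cases i <;> simp

theorem subst_x_x (a : Ass k 2) : subst ![x 0, x 1] a = a := by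
  conv_rhs => rw [← subst_id a]
  congr 2
  funext i; fin_cases i <;> rfl

theorem vec_nil {q r : Ass k m} (hq : q [] = 0) (hr : r [] = 0) : ∀ i, ![q, r] i [] = 0 :=
  Fin.forall_fin_two.2 ⟨hq, hr⟩

theorem maps_nil {u : Fin 2 → Ass k 2} (hu : u ∈ dert k 2) : (∀ i, map_1_2 u i [] = 0) ∧ (∀ i, map_12_3 u i [] = 0) ∧
    (∀ i, map_2_3 u i [] = 0) ∧ (∀ i, map_1_23 u i [] = 0) := by
  have h : ∀ (b : Fin 2 → Ass k 3) i, subst b (u i) [] = 0 := fun b i =>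
    (subst_nil _).trans (dert_nil hu i)
  refine ⟨?_, ?_, ?_, ?_⟩ <;> intro i <;> fin_cases i
  exacts [h _ 0, h _ 1, rfl, h _ 0, h _ 0, h _ 1, rfl, h _ 0, h _ 1, h _ 0, h _ 1, h _ 1]

theorem restr_succ_x : restr Fin.succ (x 0 : Ass k 3) = (0 : Ass k 2)
    ∧ restr Fin.succ (x 1 : Ass k 3) = (x 0 : Ass k 2)
    ∧ restr Fin.succ (x 2 : Ass k 3) = (x 1 : Ass k 2) :=
  ⟨restr_x_of_notMem fun i => Fin.succ_ne_zero i,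
    restr_x_of_injective (Fin.succ_injective 2) 0, restr_x_of_injective (Fin.succ_injective 2) 1⟩

theorem restr_castSucc_x : restr Fin.castSucc (x 0 : Ass k 3) = (x 0 : Ass k 2)
    ∧ restr Fin.castSucc (x 1 : Ass k 3) = (x 1 : Ass k 2)
    ∧ restr Fin.castSucc (x 2 : Ass k 3) = (0 : Ass k 2) :=
  ⟨restr_x_of_injective (Fin.castSucc_injective 2) 0,
    restr_x_of_injective (Fin.castSucc_injective 2) 1,
    restr_x_of_notMem fun i => Fin.castSucc_ne_last i⟩

theorem x_add_x_nil (i j : Fin n) : (x i + x j : Ass k n) [] = 0 := by simp [x_nil]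

theorem cts_inner (a : Ass k n) :
    Cts (LinearMap.mulRight k a + LinearMap.mulLeft k (-a)) :=
  (cts_mulRight _).add (cts_mulLeft _)

theorem smul_x_mem_lie {n : ℕ} (c : k) (i : Fin n) : c • x i ∈ lie k n := fun d => by
  have hx : (x i : Ass k n) ∈ liePoly k n := LieSubalgebra.subset_lieSpan ⟨i, rfl⟩
  by_cases hd : d = 1
  · have : component d (c • x i : Ass k n) = c • x i := by
      ext w
      by_cases hw : w.length = d
      · simp [component, hw]
      · have : w ≠ [i] := by rintro rfl; exact hw (by simp [hd])
        simp [component, hw, x, word, this]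
    rw [this]
    exact (liePoly k n).smul_mem c hx
  · have : component d (c • x i : Ass k n) = 0 := by
      ext w
      by_cases hw : w.length = d
      · have : w ≠ [i] := by rintro rfl; exact hd (by simpa using hw.symm)
        simp [component, x, word, this]
      · simp [component, hw]
    rw [this]
    exact (liePoly k n).zero_mem

theorem restr_subst_pair (ι : Fin m → Fin 3) {q r : Ass k 3} (hq : q [] = 0) (hr : r [] = 0)
    (a : Ass k 2) : restr ι (subst ![q, r] a) = subst ![restr ι q, restr ι r] a := by
  rw [restr_subst ι (vec_nil hq hr)]
  congr 2
  funext i; fin_cases i <;> rfl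

/-- A derivation is inner as soon as it is so on the generators. -/
theorem der_eq_inner {u : Fin n → Ass k n} {a : Ass k n}
    (h : ∀ i, x i * u i - u i * x i = x i * a - a * x i) :
    der u = LinearMap.mulRight k a + LinearMap.mulLeft k (-a) := by
  refine (cts_der _).ext_gen (cts_inner a) (by simp [der_one]) fun i f hf => ?_
  rw [der_x_mul, hf, h]
  simp only [LinearMap.add_apply, LinearMap.mulRight_apply, LinearMap.mulLeft_apply]
  noncomm_ring

theorem smul_t_mem_dert (c : k) : c • t k ∈ dert k 2 :=
  Fin.forall_fin_two.2
    ⟨⟨smul_x_mem_lie c 1, by simp [t, x, word]⟩, ⟨smul_x_mem_lie c 0, by simp [t, x, word]⟩⟩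

variable [CharZero k]

/-- With the inverses cleared, only exponentials of the positive images of `u` remain to be
restricted. -/
theorem pentagonSol_spec (u : Fin 2 → Ass k 2) (f : Ass k 3) :
    expAut (map_1_2 u) (expAut (map_12_3 u) (pentagonSol u f))
      = expAut (map_2_3 u) (expAut (map_1_23 u) f) := by
  change expAut (map_1_2 u) (expAut (map_12_3 u) (expAut (-map_12_3 u) (expAut (-map_1_2 u)
    (expAut (map_2_3 u) (expAut (map_1_23 u) f))))) = _
  rw [expAut_apply_neg, expAut_apply_neg]

theorem restr_pentagonSol {ι : Fin m → Fin 3} (hι : Function.Injective ι) (u : Fin 2 → Ass k 2)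
    {f : Ass k 3} (hf : restr ι f = 0) : restr ι (pentagonSol u f) = 0 := by
  change restr ι (expAut (-map_12_3 u) (expAut (-map_1_2 u)
    (expAut (map_2_3 u) (expAut (map_1_23 u) f)))) = 0
  simp only [restr_expAut hι, hf, map_zero]

/-- The terms of `Φ` of degree one in `x_j`, for a tangential automorphism `Φ`. -/
theorem restr_shift_pentagonSol {ι : Fin m → Fin 3} (hι : Function.Injective ι) {j : Fin 3}
    (hj : ∀ i, ι i ≠ j) (hcov : ∀ l, l = j ∨ ∃ i, ι i = l) (u : Fin 2 → Ass k 2)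
    (h12 : ∀ i, map_1_2 u i [] = 0) (h12_3 : ∀ i, map_12_3 u i [] = 0)
    (h23 : ∀ i, map_2_3 u i [] = 0) (h1_23 : ∀ i, map_1_23 u i [] = 0) :
    opExp (LinearMap.mulLeft k (restr ι (map_1_2 u j)) + der fun i => restr ι (map_1_2 u (ι i)))
      (opExp (LinearMap.mulLeft k (restr ι (map_12_3 u j))
        + der fun i => restr ι (map_12_3 u (ι i)))
        (restr ι (shiftₗ j (pentagonSol u (x j)))))
    = opExp (LinearMap.mulLeft k (restr ι (map_2_3 u j)) + der fun i => restr ι (map_2_3 u (ι i)))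
      (opExp (LinearMap.mulLeft k (restr ι (map_1_23 u j))
        + der fun i => restr ι (map_1_23 u (ι i))) 1) := by
  have hx : restr ι (x j : Ass k 3) = 0 := restr_x_of_notMem hj
  have hΦ : restr ι (pentagonSol u (x j)) = 0 := restr_pentagonSol hι u hx
  have h1 : restr ι (shiftₗ j (x j : Ass k 3)) = 1 := by simp [shiftₗ_x, restr_one]
  rw [← restr_shift_expAut hι hj hcov h12_3 hΦ, ← restr_shift_expAut hι hj hcov h12,
    pentagonSol_spec, restr_shift_expAut hι hj hcov h23, restr_shift_expAut hι hj hcov h1_23 hx, h1]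
  · rw [restr_expAut hι, hx, map_zero]
  · rw [restr_expAut hι, hΦ, map_zero]

variable {u : Fin 2 → Ass k 2}

/-- `Φ(x₀)` determines `F⁻¹(x₀)` up to conjugation by a power of `e^{x + y}`. -/
theorem exists_conj_x_zero (hu : u ∈ dert k 2) : ∃ h, IsUnit h ∧
    expAut (-u) (x 0) * h = h * x 0 ∧
    h * restr Fin.succ (shiftₗ 0 (pentagonSol u (x 0))) = exp (u 0 [1] • (x 0 + x 1)) := by
  have hu0 := dert_nil hu 0
  obtain ⟨h12, h12_3, h23, h1_23⟩ := maps_nil hu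
  set φ := restr Fin.succ (shiftₗ 0 (pentagonSol u (x 0))) with hφ
  set c := u 0 [1] with hc
  have key := restr_shift_pentagonSol (Fin.succ_injective 2) (j := 0) (fun i => Fin.succ_ne_zero i)
    (fun l => by fin_cases l <;> simp) u h12 h12_3 h23 h1_23
  rw [← hφ] at key
  obtain ⟨r0, r1, r2⟩ := restr_succ_x (k := k)
  -- Set `x = 0` and rename `y, z` to `x, y`. Both `u^{12,3}` and `u^{2,3}` become `u`. Both
  -- `u^{1,2}` and `u^{1,23}` become `0` as derivations, because `b(0, y)` is the `y`-linear term of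
  -- `b`, which vanishes; their first entries become `c x` and `c (x + y)`.
  have e1 : restr Fin.succ (map_1_2 u 0) = c • (x 0 : Ass k 2) := by
    simp only [map_1_2, Matrix.cons_val_zero]
    rw [restr_subst_pair _ (x_nil _) (x_nil _), r0, r1, subst_zero_left (hu 0).1 (x_nil _)]
  have d1 : (fun i : Fin 2 => restr Fin.succ (map_1_2 u i.succ)) = (0 : Fin 2 → Ass k 2) := by
    funext i
    fin_cases i
    · change restr Fin.succ (subst ![x 0, x 1] (u 1)) = _
      rw [restr_subst_pair _ (x_nil _) (x_nil _), r0, r1, subst_zero_left (hu 1).1 (x_nil _),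
        (hu 1).2, zero_smul]
      rfl
    · exact map_zero _
  have e2 : restr Fin.succ (map_12_3 u 0) = u 0 := by
    simp only [map_12_3, Matrix.cons_val_zero]
    rw [restr_subst_pair _ (x_add_x_nil _ _) (x_nil _), map_add, r0, r1, r2, zero_add, subst_x_x]
  have d2 : (fun i : Fin 2 => restr Fin.succ (map_12_3 u i.succ)) = u := by
    funext i
    fin_cases i
    · exact e2
    · change restr Fin.succ (subst ![x 0 + x 1, x 2] (u 1)) = _
      rw [restr_subst_pair _ (x_add_x_nil _ _) (x_nil _), map_add, r0, r1, r2, zero_add, subst_x_x]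
      rfl
  have e3 : restr Fin.succ (map_2_3 u 0) = (0 : Ass k 2) := map_zero _
  have d3 : (fun i : Fin 2 => restr Fin.succ (map_2_3 u i.succ)) = u := by
    funext i
    fin_cases i
    · change restr Fin.succ (subst ![x 1, x 2] (u 0)) = _
      rw [restr_subst_pair _ (x_nil _) (x_nil _), r1, r2, subst_x_x]; rfl
    · change restr Fin.succ (subst ![x 1, x 2] (u 1)) = _
      rw [restr_subst_pair _ (x_nil _) (x_nil _), r1, r2, subst_x_x]; rfl
  have e4 : restr Fin.succ (map_1_23 u 0) = c • (x 0 + x 1 : Ass k 2) := by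
    simp only [map_1_23, Matrix.cons_val_zero]
    rw [restr_subst_pair _ (x_nil _) (x_add_x_nil _ _), map_add, r0, r1, r2,
      subst_zero_left (hu 0).1 (x_add_x_nil _ _)]
  have d4 : (fun i : Fin 2 => restr Fin.succ (map_1_23 u i.succ)) = (0 : Fin 2 → Ass k 2) := by
    have : restr Fin.succ (subst ![x 0, x 1 + x 2] (u 1)) = (0 : Ass k 2) := by
      rw [restr_subst_pair _ (x_nil _) (x_add_x_nil _ _), map_add, r0, r1, r2,
        subst_zero_left (hu 1).1 (x_add_x_nil _ _), (hu 1).2, zero_smul]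
    funext i
    fin_cases i <;> exact this
  rw [e1, d1, e2, d2, e3, d3, e4, d4, der_zero, add_zero, add_zero, LinearMap.mulLeft_zero_eq_zero,
    zero_add, opExp_mulLeft (by simp [x_nil]), opExp_mulLeft (by simp [x_nil]), mul_one] at key
  -- The factor `exp (c • x 0)` moves inside, since the twisted exponential commutes with left
  -- multiplication by it. Applying `exp(-u)` then isolates `φ`.
  change exp (c • x 0) * opExp (twist u 0) φ = expAut u (exp (c • (x 0 + x 1))) at key
  rw [← opExp_twist_exp_mul hu0, opExp_twist hu0] at key
  have hxf := congrArg (expAut (-u)) (x_mul_conjugator hu0)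
  rw [expAut_mul, expAut_mul, expAut_neg_apply] at hxf
  have hk := congrArg (expAut (-u)) key
  rw [expAut_mul, expAut_neg_apply, expAut_neg_apply] at hk
  have hcx : Commute (exp (c • x 0)) (x 0 : Ass k 2) :=
    exp_commute (by simp [x_nil]) (Commute.smul_left (Commute.refl _) c)
  -- The extra factor commutes with `x 0`, so it does not disturb the conjugation relation.
  refine ⟨expAut (-u) (conjugator u 0) * exp (c • x 0),
    (isUnit_expAut _ (isUnit_conjugator hu0)).mul (isUnit_exp (by simp [x_nil])), ?_, ?_⟩
  · rw [← mul_assoc, hxf, mul_assoc, mul_assoc, hcx.eq]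
  · rw [mul_assoc, hk]

/-- `Φ(x₂)` determines `F⁻¹(x₁)` up to conjugation by a power of `e^{x + y}`. -/
theorem exists_conj_x_one (hu : u ∈ dert k 2) : ∃ h, IsUnit h ∧
    expAut (-u) (x 1) * h = h * x 1 ∧
    h = exp (u 1 [0] • (x 0 + x 1)) * restr Fin.castSucc (shiftₗ 2 (pentagonSol u (x 2))) := by
  have hu1 := dert_nil hu 1
  obtain ⟨h12, h12_3, h23, h1_23⟩ := maps_nil hu
  set φ := restr Fin.castSucc (shiftₗ 2 (pentagonSol u (x 2))) with hφ
  set c := u 1 [0] with hc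
  have key := restr_shift_pentagonSol (Fin.castSucc_injective 2) (j := 2)
    (fun i => Fin.castSucc_ne_last i)
    (fun l => by fin_cases l <;> simp [Fin.exists_fin_two]) u h12 h12_3 h23 h1_23
  rw [← hφ] at key
  obtain ⟨r0, r1, r2⟩ := restr_castSucc_x (k := k)
  -- Set `z = 0`. Now `u^{1,2}` and `u^{1,23}` become `u`, while `u^{12,3}` and `u^{2,3}` become `0`
  -- as derivations, with last entries `c (x + y)` and `c y`.
  have e1 : restr Fin.castSucc (map_1_2 u 2) = (0 : Ass k 2) := map_zero _
  have d1 : (fun i : Fin 2 => restr Fin.castSucc (map_1_2 u i.castSucc)) = u := by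
    funext i
    fin_cases i
    · change restr Fin.castSucc (subst ![x 0, x 1] (u 0)) = _
      rw [restr_subst_pair _ (x_nil _) (x_nil _), r0, r1, subst_x_x]; rfl
    · change restr Fin.castSucc (subst ![x 0, x 1] (u 1)) = _
      rw [restr_subst_pair _ (x_nil _) (x_nil _), r0, r1, subst_x_x]; rfl
  have e2 : restr Fin.castSucc (map_12_3 u 2) = c • (x 0 + x 1 : Ass k 2) := by
    change restr Fin.castSucc (subst ![x 0 + x 1, x 2] (u 1)) = _
    rw [restr_subst_pair _ (x_add_x_nil _ _) (x_nil _), map_add, r0, r1, r2,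
      subst_zero_right (hu 1).1 (x_add_x_nil _ _)]
  have d2 : (fun i : Fin 2 => restr Fin.castSucc (map_12_3 u i.castSucc))
      = (0 : Fin 2 → Ass k 2) := by
    have : restr Fin.castSucc (subst ![x 0 + x 1, x 2] (u 0)) = (0 : Ass k 2) := by
      rw [restr_subst_pair _ (x_add_x_nil _ _) (x_nil _), map_add, r0, r1, r2,
        subst_zero_right (hu 0).1 (x_add_x_nil _ _), (hu 0).2, zero_smul]
    funext i
    fin_cases i <;> exact this
  have e3 : restr Fin.castSucc (map_2_3 u 2) = c • (x 1 : Ass k 2) := by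
    change restr Fin.castSucc (subst ![x 1, x 2] (u 1)) = _
    rw [restr_subst_pair _ (x_nil _) (x_nil _), r1, r2, subst_zero_right (hu 1).1 (x_nil _)]
  have d3 : (fun i : Fin 2 => restr Fin.castSucc (map_2_3 u i.castSucc))
      = (0 : Fin 2 → Ass k 2) := by
    funext i
    fin_cases i
    · exact map_zero _
    · change restr Fin.castSucc (subst ![x 1, x 2] (u 0)) = _
      rw [restr_subst_pair _ (x_nil _) (x_nil _), r1, r2, subst_zero_right (hu 0).1 (x_nil _),
        (hu 0).2, zero_smul]
      rfl
  have e4 : ∀ j, restr Fin.castSucc (subst ![x 0, x 1 + x 2] (u j)) = u j := fun j => by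
    rw [restr_subst_pair _ (x_nil _) (x_add_x_nil _ _), map_add, r0, r1, r2, add_zero, subst_x_x]
  have d4 : (fun i : Fin 2 => restr Fin.castSucc (map_1_23 u i.castSucc)) = u := by
    funext i
    fin_cases i
    exacts [e4 0, e4 1]
  rw [e1, d1, e2, d2, e3, d3, show restr Fin.castSucc (map_1_23 u 2) = u 1 from e4 1, d4, der_zero,
    add_zero, add_zero, LinearMap.mulLeft_zero_eq_zero,
    zero_add, opExp_mulLeft (by simp [x_nil]), opExp_mulLeft (by simp [x_nil])] at key
  change expAut u (exp (c • (x 0 + x 1)) * φ) = exp (c • x 1) * opExp (twist u 1) 1 at key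
  rw [← opExp_twist_exp_mul hu1, opExp_twist hu1, mul_one] at key
  have hxf := congrArg (expAut (-u)) (x_mul_conjugator hu1)
  rw [expAut_mul, expAut_mul, expAut_neg_apply] at hxf
  have hk := congrArg (expAut (-u)) key
  rw [expAut_neg_apply, expAut_mul, expAut_neg_apply] at hk
  have hcx : Commute (exp (c • x 1)) (x 1 : Ass k 2) :=
    exp_commute (by simp [x_nil]) (Commute.smul_left (Commute.refl _) c)
  refine ⟨expAut (-u) (conjugator u 1) * exp (c • x 1),
    (isUnit_expAut _ (isUnit_conjugator hu1)).mul (isUnit_exp (by simp [x_nil])), ?_, hk.symm⟩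
  rw [← mul_assoc, hxf, mul_assoc, mul_assoc, hcx.eq]

/-- In degree two only the linear term of `exp(u)` contributes, since `u²` raises `x + y` to order
three. -/
theorem expAut_coeff (u : Fin 2 → Ass k 2) :
    expAut u (x 0 + x 1) [0, 1] = u 0 [1] - u 1 [0] := by
  have h2 : (der u ^ 2) (x 0 + x 1) [0, 1] = 0 :=
    orderGE_der_pow u ((orderGE_x 0).add (orderGE_x 1)) 2 _ (by simp)
  have h3 : der u (x 0 + x 1) [0, 1] = u 0 [1] - u 1 [0] := by
    rw [map_add, der_x, der_x]
    simp [mul_apply, Finset.sum_range_succ, x, word, sub_eq_add_neg]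
  have h4 : (x 0 + x 1 : Ass k 2) [0, 1] = 0 := by simp [x, word]
  rw [expAut_apply, opExp_apply]
  simp only [List.length_cons, List.length_nil, Finset.sum_range_succ, Finset.sum_range_zero,
    h2, pow_one, pow_zero, Module.End.one_apply, h3, h4]
  simp

theorem expAut_eq_conj {u : Fin n → Ass k n} {a : Ass k n} (ha : a [] = 0)
    (h : der u = LinearMap.mulRight k a + LinearMap.mulLeft k (-a)) (f : Ass k n) :
    expAut u f = exp (-a) * f * exp a := by
  have ha' : (-a) [] = 0 := by simp [ha]
  rw [expAut_apply, h, opExp_add (raises_mulRight ha) (raises_mulLeft ha')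
    (LinearMap.ext fun f => (mul_assoc (-a) f a)), opExp_mulRight ha, opExp_mulLeft ha']

/-- On generators: `[x, y] = [x, x + y]` and `[y, x] = [y, x + y]`. -/
theorem der_smul_t (c : k) : der (c • t k) = LinearMap.mulRight k (c • (x 0 + x 1))
    + LinearMap.mulLeft k (-(c • (x 0 + x 1))) := by
  have h0 : (c • t k) 0 = c • x 1 := rfl
  have h1 : (c • t k) 1 = c • x 0 := rfl
  refine der_eq_inner (Fin.forall_fin_two.2 ⟨?_, ?_⟩)
  · rw [h0]
    simp only [mul_smul_comm, smul_mul_assoc, mul_add, add_mul, smul_add]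
    abel
  · rw [h1]
    simp only [mul_smul_comm, smul_mul_assoc, mul_add, add_mul, smul_add]
    abel

/-- The series conjugating `xᵢ` to `F₁⁻¹(xᵢ)` and to `F₂⁻¹(xᵢ)` differ by a left factor
`e^{μ(x+y)}`, with the same `μ` for both generators. Hence `F₂⁻¹ = Ad(e^{μ(x+y)}) F₁⁻¹`, and `F₁⁻¹
F₂` is the inner automorphism `exp(μ t)`. -/
theorem eq_mul_expAut_t_of_pentagonSol_eq {u₁ u₂ : Fin 2 → Ass k 2} (h₁ : u₁ ∈ dert k 2)
    (h₂ : u₂ ∈ dert k 2) (hch : expAut u₁ (x 0 + x 1) = expAut u₂ (x 0 + x 1))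
    (hΦ : pentagonSol u₁ = pentagonSol u₂) :
    ∃ c : k, expAut u₂ = expAut u₁ * expAut (c • t k) := by
  set s : Ass k 2 := x 0 + x 1 with hs
  have hsn : ∀ c : k, (c • s) [] = 0 := fun c => by simp [hs, x_nil]
  obtain ⟨g₁, hg₁, hc₁, he₁⟩ := exists_conj_x_zero h₁
  obtain ⟨g₂, hg₂, hc₂, he₂⟩ := exists_conj_x_zero h₂
  obtain ⟨f₁, hf₁, hd₁, hi₁⟩ := exists_conj_x_one h₁
  obtain ⟨f₂, hf₂, hd₂, hi₂⟩ := exists_conj_x_one h₂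
  rw [← hΦ, ← hs] at he₂ hi₂
  rw [← hs] at he₁ hi₁
  set μ : k := u₂ 0 [1] - u₁ 0 [1] with hμ
  -- The coefficient of `xy` in the common value at `x + y` ties the two exponents together.
  have hμ' : u₂ 1 [0] - u₁ 1 [0] = μ := by
    have := congrFun hch [0, 1]
    rw [expAut_coeff, expAut_coeff] at this
    rw [hμ]; linear_combination this
  have hexp : ∀ a b : k, exp ((a + b) • s) = exp (a • s) * exp (b • s) := fun a b => by
    rw [add_smul]
    exact exp_add_of_commute (hsn _) (hsn _)
      (((Commute.refl s).smul_left a).smul_right b)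
  have hg : g₂ = exp (μ • s) * g₁ := by
    have hU : IsUnit (restr Fin.succ (shiftₗ 0 (pentagonSol u₁ (x 0)))) := by
      obtain ⟨v, rfl⟩ := hg₁
      rw [← Units.isUnit_units_mul v, he₁]
      exact isUnit_exp (hsn _)
    apply hU.mul_right_cancel
    rw [he₂, mul_assoc, he₁, ← hexp, hμ, sub_add_cancel]
  have hf : f₂ = exp (μ • s) * f₁ := by
    rw [hi₂, hi₁, ← mul_assoc, ← hexp, ← hμ', sub_add_cancel]
  have hx : ∀ i, expAut (-u₂) (x i) * exp (μ • s) = exp (μ • s) * expAut (-u₁) (x i) := by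
    intro i
    fin_cases i
    · apply hg₁.mul_right_cancel
      change expAut (-u₂) (x 0) * exp (μ • s) * g₁ = exp (μ • s) * expAut (-u₁) (x 0) * g₁
      rw [mul_assoc, ← hg, hc₂, mul_assoc, hc₁, hg, mul_assoc]
    · apply hf₁.mul_right_cancel
      change expAut (-u₂) (x 1) * exp (μ • s) * f₁ = exp (μ • s) * expAut (-u₁) (x 1) * f₁
      rw [mul_assoc, ← hf, hd₂, mul_assoc, hd₁, hf, mul_assoc]
  have hall : LinearMap.mulRight k (exp (μ • s)) ∘ₗ (expAut (-u₂) : Ass k 2 →ₗ[k] Ass k 2)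
      = LinearMap.mulLeft k (exp (μ • s)) ∘ₗ (expAut (-u₁) : Ass k 2 →ₗ[k] Ass k 2) := by
    refine ((cts_mulRight _).comp (cts_expAut _)).ext_gen ((cts_mulLeft _).comp (cts_expAut _))
      (by simp [expAut_one]) fun i f hf => ?_
    simp only [LinearMap.comp_apply, LinearMap.mulRight_apply, LinearMap.mulLeft_apply,
      LinearEquiv.coe_coe] at hf ⊢
    rw [expAut_mul, expAut_mul, mul_assoc, hf, ← mul_assoc, hx, mul_assoc]
  refine ⟨μ, LinearEquiv.ext fun f => ?_⟩
  have h := LinearMap.congr_fun hall (expAut u₂ f)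
  simp only [LinearMap.comp_apply, LinearMap.mulRight_apply, LinearMap.mulLeft_apply,
      LinearEquiv.coe_coe] at h
  rw [expAut_neg_apply] at h
  have hT : expAut (μ • t k) f = expAut (-u₁) (expAut u₂ f) := by
    rw [expAut_eq_conj (hsn μ) (der_smul_t μ), mul_assoc, h, ← mul_assoc]
    have := exp_mul_exp_neg (a := -(μ • s)) (by simp [hsn])
    rw [neg_neg] at this
    rw [this, one_mul]
  rw [LinearEquiv.mul_apply, hT, expAut_apply_neg]

end

/-! ### The series `e^{ln b}` and the associativity of the Campbell–Hausdorff series -/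

section ExpLn

variable {k : Type*} [Field k] {n m : ℕ}

theorem evalSeries_sub (c : ℕ → k) {a : Ass k n} (ha : a [] = 0) (N : ℕ) :
    OrderGE N (evalSeries c a - ∑ j ∈ Finset.range N, c j • a ^ j) := fun w hw => by
  have hp : ∀ j, OrderGE j (a ^ j) := fun j => by
    induction j with
    | zero => exact orderGE_zero _
    | succ j ih => rw [pow_succ]; exact ih.mul (orderGE_one_iff.2 ha)
  rw [sub_apply, sum_apply, sub_eq_zero]
  refine Finset.sum_subset (fun j hj => ?_) (fun j _ hj => ?_)
  · rw [Finset.mem_range] at hj ⊢; omega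
  · rw [Finset.mem_range, not_lt] at hj
    rw [hp j w (by omega), mul_zero]

theorem map_evalSeries {G : Ass k n →ₗ[k] Ass k m} (hG : Cts G) (h1 : G 1 = 1)
    (hmul : ∀ f g, G (f * g) = G f * G g) (c : ℕ → k) {a : Ass k n} (ha : a [] = 0)
    (hGa : G a [] = 0) : G (evalSeries c a) = evalSeries c (G a) := by
  have hp : ∀ j, G (a ^ j) = G a ^ j := fun j => by
    induction j with
    | zero => simpa using h1
    | succ j ih => rw [pow_succ, pow_succ, hmul, ih]
  ext w
  obtain ⟨M, hM⟩ := hG (w.length + 1)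
  have e1 := hM _ ((evalSeries_sub c ha (max M (w.length + 1))).mono (le_max_left _ _)) w
    (by omega)
  have e2 := evalSeries_sub c hGa (max M (w.length + 1)) w (by omega)
  rw [map_sub, sub_apply, sub_eq_zero] at e1
  rw [sub_apply, sub_eq_zero] at e2
  rw [e1, e2]
  simp [hp]

theorem map_exp {G : Ass k n →ₗ[k] Ass k m} (hG : Cts G) (h1 : G 1 = 1)
    (hmul : ∀ f g, G (f * g) = G f * G g) {a : Ass k n} (ha : a [] = 0) (hGa : G a [] = 0) :
    G (exp a) = exp (G a) := map_evalSeries hG h1 hmul _ ha hGa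

theorem map_ln {G : Ass k n →ₗ[k] Ass k m} (hG : Cts G) (h1 : G 1 = 1)
    (hmul : ∀ f g, G (f * g) = G f * G g) {b : Ass k n} (hb : b [] = 1) (hGb : G b [] = 1) :
    G (ln b) = ln (G b) := by
  rw [ln, map_neg, map_evalSeries hG h1 hmul _ (by simp [hb, one_apply])
    (by rw [map_sub, h1, sub_apply, hGb]; simp [one_apply]), map_sub, h1, ln]

theorem exp_nil (a : Ass k n) : exp a [] = 1 := by
  simp [exp, evalSeries, one_apply]

theorem ln_nil (b : Ass k n) : ln b [] = 0 := by
  simp [ln, evalSeries]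

/-- The Euler derivation, which multiplies a series of degree `d` by `d`. -/
def euler : Ass k n →ₗ[k] Ass k n where
  toFun f := fun w => w.length * f w
  map_add' f g := by ext w; exact mul_add _ _ _
  map_smul' c f := by ext w; exact mul_left_comm _ _ _

theorem euler_apply (f : Ass k n) (w : List (Fin n)) : euler f w = w.length * f w := rfl

theorem euler_mul (f g : Ass k n) : euler (f * g) = euler f * g + f * euler g := by
  ext w
  rw [euler_apply, add_apply, mul_apply, mul_apply, mul_apply, Finset.mul_sum,
    ← Finset.sum_add_distrib]
  refine Finset.sum_congr rfl fun i hi => ?_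
  rw [Finset.mem_range] at hi
  rw [euler_apply, euler_apply, List.length_take, List.length_drop, min_eq_left (by omega),
    Nat.cast_sub (by omega)]
  ring

theorem OrderGE.euler {d : ℕ} {f : Ass k n} (hf : OrderGE d f) : OrderGE d (euler f) :=
  fun w hw => by rw [euler_apply, hf w hw, mul_zero]

theorem mul_comm_of_one_variable (a b : Ass k 1) : a * b = b * a := by
  ext w
  have : w = List.replicate w.length 0 := List.eq_replicate_of_mem fun i _ => Subsingleton.elim _ _
  rw [this, mul_replicate]

theorem euler_pow (a : Ass k 1) (j : ℕ) : euler (a ^ (j + 1)) = (j + 1 : k) • (a ^ j * euler a) := by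
  induction j with
  | zero => simp
  | succ j ih =>
    rw [pow_succ, euler_mul, ih, smul_mul_assoc, mul_assoc, mul_comm_of_one_variable (euler a),
      ← mul_assoc, ← pow_succ]
    push_cast
    module

theorem x_pow_apply (j : ℕ) (w : List (Fin 1)) :
    ((x 0 : Ass k 1) ^ j) w = if w.length = j then 1 else 0 := by
  induction j generalizing w with
  | zero => simp [one_apply]
  | succ j ih =>
    rw [pow_succ']
    cases w with
    | nil => rw [x_mul_nil]; simp
    | cons i w => rw [x_mul_cons, ih]; simp [Subsingleton.elim i 0]

theorem subst_ch {b : Fin 2 → Ass k m} (hb : ∀ i, b i [] = 0) :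
    subst b (ch k) = ln (exp (b 0) * exp (b 1)) := by
  have h : subst b (exp (x 0) * exp (x 1)) = exp (b 0) * exp (b 1) := by
    rw [subst_mul hb, map_exp (cts_subst hb) (subst_one hb) (subst_mul hb) (x_nil _)
      (by rw [subst_x hb, hb]), map_exp (cts_subst hb) (subst_one hb) (subst_mul hb) (x_nil _)
      (by rw [subst_x hb, hb]), subst_x hb, subst_x hb]
  rw [ch, map_ln (cts_subst hb) (subst_one hb) (subst_mul hb) (by simp [exp_nil])
    (by rw [h]; simp [exp_nil]), h]

variable [CharZero k]

/-- One variable makes the algebra commutative, so the power rule applies term by term. -/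
theorem euler_exp {a : Ass k 1} (ha : a [] = 0) : euler (exp a) = exp a * euler a := by
  ext w
  set N := w.length with hN
  -- The left side is truncated one term later, because its term of index `0` is killed by `euler`
  -- and the others shift by one.
  have h1 := ((evalSeries_sub (fun j => (j.factorial : k)⁻¹) ha (N + 2)).euler) w (by omega)
  have h2 := ((evalSeries_sub (fun j => (j.factorial : k)⁻¹) ha (N + 1)).mul
    (orderGE_zero (euler a))) w (by omega)
  rw [map_sub, sub_apply, sub_eq_zero] at h1
  rw [sub_mul, sub_apply, sub_eq_zero] at h2
  rw [exp, h1, h2, Finset.sum_range_succ', map_add, map_sum, Finset.sum_mul]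
  have h3 : euler (1 : Ass k 1) = 0 := by
    ext w
    cases w <;> simp [euler_apply, one_apply]
  have h4 : ∀ j : ℕ, euler (((j + 1).factorial : k)⁻¹ • a ^ (j + 1))
      = ((j.factorial : k)⁻¹ • a ^ j) * euler a := fun j => by
    have e1 : (j.factorial : k) ≠ 0 := Nat.cast_ne_zero.2 j.factorial_ne_zero
    have e2 : (j + 1 : k) ≠ 0 := by exact_mod_cast j.succ_ne_zero
    rw [map_smul, euler_pow, smul_smul, smul_mul_assoc, Nat.factorial_succ]
    congr 1
    push_cast
    field_simp
  simp only [h4, map_smul, pow_zero, h3, smul_zero, add_zero]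

/-- With `θ` the Euler derivation, `L = ln(1 - x)` satisfies `(1 - x) θL = -x`, so `E = e^L`
satisfies `(1 - x) θE = -xE`. In characteristic `0` this recursion and the constant term `1`
determine `E`. -/
theorem exp_ln_one_sub_x : exp (ln (1 - x 0 : Ass k 1)) = 1 - x 0 := by
  set L := ln (1 - x 0 : Ass k 1) with hL
  have hLw : ∀ w, L w = -(w.length : k)⁻¹ := fun w => by
    simp [hL, ln, evalSeries, x_pow_apply]
  have hθ : euler L - x 0 * euler L = -x 0 := by
    ext w
    cases w with
    | nil => rw [sub_apply, x_mul_nil, euler_apply]; simp [x_nil]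
    | cons i w =>
      obtain rfl : i = 0 := Subsingleton.elim _ _
      have e : (w.length + 1 : k) ≠ 0 := by exact_mod_cast w.length.succ_ne_zero
      rw [sub_apply, x_mul_cons, euler_apply, euler_apply, hLw, hLw]
      cases w with
      | nil => simp [x, word]
      | cons j w =>
        have e' : (w.length + 1 : k) ≠ 0 := by exact_mod_cast w.length.succ_ne_zero
        simp only [List.length_cons, Nat.cast_add, Nat.cast_one] at e ⊢
        simp [x, word, e, e']
  have hE : euler (exp L) - x 0 * euler (exp L) = -(x 0 * exp L) := by
    rw [euler_exp (ln_nil _), mul_comm_of_one_variable (exp L), ← mul_assoc, ← sub_mul, hθ, neg_mul]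
  ext w
  induction w with
  | nil => simp [exp_nil, one_apply, x_nil]
  | cons i w ih =>
    obtain rfl : i = 0 := Subsingleton.elim _ _
    have e : (w.length + 1 : k) ≠ 0 := by exact_mod_cast w.length.succ_ne_zero
    have h := congrFun hE (0 :: w)
    rw [sub_apply, neg_apply, x_mul_cons, x_mul_cons, euler_apply, euler_apply, if_pos rfl,
      if_pos rfl, ih, List.length_cons] at h
    push_cast at h
    apply mul_left_cancel₀ e
    rw [sub_eq_iff_eq_add] at h
    rw [h]
    -- The recursion reads `(d + 1) E_{d+1} = (d - 1) E_d`: it gives `-1` for `d = 0`, then `0` for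
    -- `d = 1`, and `0` from then on.
    match w with
    | [] => simp [one_apply, x, word]
    | [j] => simp [one_apply, x, word, Subsingleton.elim j 0]
    | i :: j :: w => simp [one_apply, x, word]

/-- Substitute `1 - b` for the variable in the one-variable identity. -/
theorem exp_ln {b : Ass k n} (hb : b [] = 1) : exp (ln b) = b := by
  have ha : ∀ i : Fin 1, (fun _ => 1 - b : Fin 1 → Ass k n) i [] = 0 := fun _ => by
    simp [hb, one_apply]
  have hx : subst (fun _ => 1 - b : Fin 1 → Ass k n) (1 - x 0) = b := by
    rw [map_sub, subst_one ha, subst_x ha, sub_sub_cancel]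
  have h := congrArg (subst (fun _ => 1 - b : Fin 1 → Ass k n)) (exp_ln_one_sub_x (k := k))
  rwa [map_exp (cts_subst ha) (subst_one ha) (subst_mul ha) (ln_nil _)
    ((subst_nil _).trans (ln_nil _)), map_ln (cts_subst ha) (subst_one ha) (subst_mul ha)
    (by simp [one_apply, x_nil]) (by rw [hx, hb]), hx] at h

/-- Both sides are `ln(e^a e^b e^c)`. -/
theorem ch_assoc {a b c : Ass k m} (ha : a [] = 0) (hb : b [] = 0) (hc : c [] = 0) :
    subst ![subst ![a, b] (ch k), c] (ch k) = subst ![a, subst ![b, c] (ch k)] (ch k) := by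
  have h : ∀ b : Fin 2 → Ass k m, subst b (ch k) [] = 0 := fun b => (subst_nil _).trans ch_nil
  rw [subst_ch (vec_nil (h _) hc), subst_ch (vec_nil ha (h _)), subst_ch (vec_nil ha hb),
    subst_ch (vec_nil hb hc)]
  simp only [Matrix.cons_val_zero, Matrix.cons_val_one]
  rw [exp_ln (by simp [exp_nil]), exp_ln (by simp [exp_nil]), mul_assoc]

end ExpLn

/-! ### Uniqueness of the normalized conjugator -/

section Conjugator

variable {k : Type*} [Field k] {n m : ℕ}

theorem mul_word_append (f : Ass k n) {v w : List (Fin n)} (u : List (Fin n))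
    (h : w.length = v.length) : (f * word v : Ass k n) (u ++ w) = if w = v then f u else 0 := by
  rw [mul_apply, Finset.sum_eq_single u.length]
  · by_cases hw : w = v <;> simp [word, hw]
  · intro i hi hne
    have : (u ++ w).drop i ≠ v := fun hv => by
      have := congrArg List.length hv
      rw [Finset.mem_range] at hi
      rw [List.length_drop, List.length_append] at this
      rw [List.length_append] at hi
      omega
    rw [word, if_neg this, mul_zero]
  · intro h
    exact absurd (Finset.mem_range.2 (by rw [List.length_append]; omega)) h

theorem word_mul_append (f : Ass k n) (v w : List (Fin n)) : (word v * f : Ass k n) (v ++ w) = f w := by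
  induction v with
  | nil => rw [word_nil, one_mul]; rfl
  | cons i v ih => rw [word_cons, mul_assoc, List.cons_append, x_mul_cons, if_pos rfl, ih]

/-- A series that commutes with `xᵢ` is a series in `xᵢ`. -/
theorem eq_one_of_commute_x {a : Ass k n} {i : Fin n} (h : Commute a (x i))
    (h1 : restr (fun _ : Fin 1 => i) a = 1) : a = 1 := by
  have hc : ∀ d, Commute a (word (List.replicate d i)) := fun d => by
    induction d with
    | zero => exact Commute.one_right a
    | succ d ih => rw [List.replicate_succ, word_cons]; exact h.mul_right ih
  ext w
  by_cases hw : w = List.replicate w.length i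
  · have := congrFun h1 (List.replicate w.length 0)
    rw [restr_apply, List.map_replicate, ← hw] at this
    rw [this, one_apply, one_apply]
    simp
  -- With `d` the length of `w`, compare coefficients of `xᵢ^d w`: in `xᵢ^d a` it is that of `w` in
  -- `a`, and in `a xᵢ^d` it is `0` unless `w = xᵢ^d`.
  · have e := congrFun (hc w.length).eq.symm (List.replicate w.length i ++ w)
    rw [word_mul_append, mul_word_append _ _ (by simp), if_neg hw] at e
    rw [e, one_apply, if_neg]
    rintro rfl
    exact hw rfl

/-- The normalization in `dert` removes the linear term, the only one that a Lie series can have in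
`xᵢ` alone. This is what normalizes the conjugator. -/
theorem dert_restr {u : Fin n → Ass k n} (hu : u ∈ dert k n) (i : Fin n) :
    restr (fun _ : Fin 1 => i) (u i) = 0 := by
  ext w
  rw [restr_apply, List.map_const', zero_apply]
  by_cases h : w.length = 1
  · rw [h]; exact (hu i).2
  · exact lie_replicate (hu i).1 i h

theorem restr_conjugator {u : Fin n → Ass k n} (hu : u ∈ dert k n) (i : Fin n) :
    restr (fun _ : Fin 1 => i) (conjugator u i) = 1 := by
  rw [conjugator, map_opExp (E := 0) (cts_restr _) (raises_twist (dert_nil hu i)) raises_zero,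
    opExp_zero, restr_one]
  · rfl
  · intro f
    rw [twist, LinearMap.add_apply, map_add, LinearMap.mulLeft_apply, restr_mul, dert_restr hu,
      restr_der (Function.injective_of_subsingleton _), dert_restr hu]
    rw [zero_mul, zero_add]
    exact LinearMap.congr_fun der_zero _

variable [CharZero k]

theorem restr_expAut_of_dert {u : Fin n → Ass k n} (hu : u ∈ dert k n) (i : Fin n) (f : Ass k n) :
    restr (fun _ : Fin 1 => i) (expAut u f) = restr (fun _ : Fin 1 => i) f := by
  rw [restr_expAut (Function.injective_of_subsingleton _), dert_restr hu]
  exact expAut_zero _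

/-- Both sides conjugate `xᵢ` to `exp(u₂)(xᵢ)`, so their quotient commutes with `xᵢ`. Both have part
`1` in `xᵢ` alone, so the quotient is `1`. -/
theorem conjugator_mul {u₁ u₂ w : Fin n → Ass k n} (h₁ : u₁ ∈ dert k n) (h₂ : u₂ ∈ dert k n)
    (hw : w ∈ dert k n) (h : expAut u₂ = expAut u₁ * expAut w) (i : Fin n) :
    conjugator u₂ i = conjugator u₁ i * expAut u₁ (conjugator w i) := by
  set g := conjugator u₁ i * expAut u₁ (conjugator w i) with hg
  have hgU : IsUnit g := (isUnit_conjugator (dert_nil h₁ i)).mul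
    (isUnit_expAut _ (isUnit_conjugator (dert_nil hw i)))
  have hgx : x i * g = g * expAut u₂ (x i) := by
    rw [h, LinearEquiv.mul_apply, hg, ← mul_assoc, x_mul_conjugator (dert_nil h₁ i), mul_assoc,
      mul_assoc, ← expAut_mul, ← expAut_mul, x_mul_conjugator (dert_nil hw i)]
  have hgr : restr (fun _ : Fin 1 => i) g = 1 := by
    rw [hg, restr_mul, restr_expAut_of_dert h₁, restr_conjugator h₁, restr_conjugator hw, mul_one]
  obtain ⟨r, hvv, hvv'⟩ : ∃ r, g * r = 1 ∧ r * g = 1 := by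
    obtain ⟨v, hv⟩ := hgU
    exact ⟨↑v⁻¹, by rw [← hv, Units.mul_inv], by rw [← hv, Units.inv_mul]⟩
  have hvx : expAut u₂ (x i) * r = r * x i := by
    rw [← one_mul (expAut u₂ (x i)), ← hvv', mul_assoc _ g, ← hgx, mul_assoc, mul_assoc, hvv,
      mul_one]
  have hp : conjugator u₂ i * r = 1 := by
    refine eq_one_of_commute_x (i := i) ?_ ?_
    · change conjugator u₂ i * r * x i = x i * (conjugator u₂ i * r)
      rw [mul_assoc, ← hvx, ← mul_assoc, ← x_mul_conjugator (dert_nil h₂ i), mul_assoc]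
    · have := congrArg (restr (fun _ : Fin 1 => i)) hvv
      rw [restr_mul, hgr, one_mul, restr_one] at this
      rw [restr_mul, restr_conjugator h₂, this, one_mul]
  calc conjugator u₂ i = conjugator u₂ i * r * g := by rw [mul_assoc, hvv', mul_one]
    _ = g := by rw [hp, one_mul]

end Conjugator

/-! ### Cablings of tangential derivations -/

section Cable

variable {k : Type*} [Field k] {n m : ℕ}

/-- The sum of the strands `xᵢ` with label `p`. -/
noncomputable def strands (j : Fin m → Option (Fin n)) (p : Fin n) : Ass k m :=
  ∑ i with j i = some p, x i

/-- The tangential derivation that acts on the strands labelled `p` through `u_p`, evaluated at the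
sums of strands, and trivially on the strands without label. -/
noncomputable def cable (j : Fin m → Option (Fin n)) (u : Fin n → Ass k n) : Fin m → Ass k m :=
  fun i => (j i).elim 0 fun p => subst (strands j) (u p)

variable {j : Fin m → Option (Fin n)}

theorem strands_nil (j : Fin m → Option (Fin n)) (p : Fin n) : (strands j p : Ass k m) [] = 0 := by
  rw [strands, sum_apply]
  exact Finset.sum_eq_zero fun i _ => x_nil i

theorem cable_some {u : Fin n → Ass k n} {i : Fin m} {p : Fin n} (h : j i = some p) :
    cable j u i = subst (strands j) (u p) := by rw [cable, h]; rfl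

theorem cable_none {u : Fin n → Ass k n} {i : Fin m} (h : j i = none) : cable j u i = 0 := by
  rw [cable, h]; rfl

theorem cable_nil {u : Fin n → Ass k n} (hu : ∀ p, u p [] = 0) (i : Fin m) :
    cable j u i [] = 0 := by
  rcases h : j i with _ | p
  · rw [cable_none h]; rfl
  · rw [cable_some h, subst_nil, hu]

/-- All strands with label `p` are bracketed with the same series, so their sum behaves as `x_p`
does under `u`. -/
theorem der_cable_subst (j : Fin m → Option (Fin n)) (u : Fin n → Ass k n) (f : Ass k n) :
    der (cable j u) (subst (strands j) f) = subst (strands j) (der u f) := by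
  have hs := strands_nil (k := k) j
  refine (map_der (cts_subst hs) (subst_one hs) (subst_mul hs) (fun p => ?_) f).symm
  rw [der_x, map_sub, subst_mul hs, subst_mul hs, subst_x hs, strands, map_sum, Finset.sum_mul,
    Finset.mul_sum, ← Finset.sum_sub_distrib]
  refine Finset.sum_congr rfl fun i hi => ?_
  rw [der_x, cable_some (Finset.mem_filter.1 hi).2]

theorem conjugator_cable {u : Fin n → Ass k n} (hu : ∀ p, u p [] = 0) {i : Fin m} {p : Fin n}
    (h : j i = some p) : conjugator (cable j u) i = subst (strands j) (conjugator u p) := by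
  have hs := strands_nil (k := k) j
  rw [conjugator, conjugator, map_opExp (cts_subst hs) (raises_twist (hu p))
    (raises_twist (cable_nil hu i)), subst_one hs]
  intro f
  simp only [twist, LinearMap.add_apply, map_add, LinearMap.mulLeft_apply, subst_mul hs,
    cable_some h, der_cable_subst]

variable [CharZero k]

theorem expAut_cable_subst (j : Fin m → Option (Fin n)) (u : Fin n → Ass k n) (f : Ass k n) :
    expAut (cable j u) (subst (strands j) f) = subst (strands j) (expAut u f) :=
  (map_opExp (cts_subst (strands_nil j)) (raises_der u) (raises_der _)
    (fun f => (der_cable_subst j u f).symm) f).symm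

/-- Cabling is multiplicative on automorphisms. -/
theorem expAut_cable_mul (j : Fin m → Option (Fin n)) {u₁ u₂ w : Fin n → Ass k n}
    (h₁ : u₁ ∈ dert k n) (h₂ : u₂ ∈ dert k n) (hw : w ∈ dert k n)
    (h : expAut u₂ = expAut u₁ * expAut w) :
    expAut (cable j u₂) = expAut (cable j u₁) * expAut (cable j w) := by
  have hx : ∀ i, expAut (cable j u₂) (x i) = expAut (cable j u₁) (expAut (cable j w) (x i)) := by
    intro i
    rcases hi : j i with _ | p
    · have h0 : ∀ u : Fin n → Ass k n, expAut (cable j u) (x i) = x i := fun u =>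
        expAut_of_der_eq_zero (by rw [der_x, cable_none hi]; simp)
      rw [h0, h0, h0]
    · have hf : conjugator (cable j u₂) i
          = conjugator (cable j u₁) i * expAut (cable j u₁) (conjugator (cable j w) i) := by
        rw [conjugator_cable (dert_nil h₁) hi, conjugator_cable (dert_nil h₂) hi,
          conjugator_cable (dert_nil hw) hi, expAut_cable_subst, conjugator_mul h₁ h₂ hw h,
          subst_mul (strands_nil j)]
      have hn : ∀ {u : Fin n → Ass k n}, u ∈ dert k n → cable j u i [] = 0 := fun hu =>
        cable_nil (dert_nil hu) i
      -- After multiplication by the conjugator of `cable j u₂`, both images become `x i` times that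
      -- conjugator, by its factorization `hf`.
      apply (isUnit_conjugator (hn h₂)).mul_left_cancel
      rw [← x_mul_conjugator (hn h₂), hf, mul_assoc, ← expAut_mul, ← x_mul_conjugator (hn hw),
        expAut_mul, ← mul_assoc, x_mul_conjugator (hn h₁), mul_assoc]
  have hc : (expAut (cable j u₂) : Ass k m →ₗ[k] Ass k m)
      = (expAut (cable j u₁) : Ass k m →ₗ[k] Ass k m) ∘ₗ (expAut (cable j w)) := by
    refine (cts_expAut _).ext_gen ((cts_expAut _).comp (cts_expAut _))
      (by simp [expAut_one]) fun i f hf => ?_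
    simp only [LinearMap.comp_apply, LinearEquiv.coe_coe] at hf ⊢
    rw [expAut_mul, expAut_mul, expAut_mul, hf, hx]
  exact LinearEquiv.ext fun f => LinearMap.congr_fun hc f

end Cable

/-! ### The four maps to three strands as cablings, and the images of `t` -/

section Pentagon

variable {k : Type*} [Field k]

theorem strands_1_2 : strands ![some 0, some 1, none] = (![x 0, x 1] : Fin 2 → Ass k 3) := by
  funext p
  fin_cases p <;> simp [strands, Finset.sum_filter, Fin.sum_univ_three]

theorem strands_2_3 : strands ![none, some 0, some 1] = (![x 1, x 2] : Fin 2 → Ass k 3) := by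
  funext p
  fin_cases p <;> simp [strands, Finset.sum_filter, Fin.sum_univ_three]

theorem strands_12_3 :
    strands ![some 0, some 0, some 1] = (![x 0 + x 1, x 2] : Fin 2 → Ass k 3) := by
  funext p
  fin_cases p <;> simp [strands, Finset.sum_filter, Fin.sum_univ_three]

theorem strands_1_23 :
    strands ![some 0, some 1, some 1] = (![x 0, x 1 + x 2] : Fin 2 → Ass k 3) := by
  funext p
  fin_cases p <;> simp [strands, Finset.sum_filter, Fin.sum_univ_three]

/-- A derivation that kills the arguments of a substitution kills its values. -/
theorem der_subst_eq_zero {n m : ℕ} {v : Fin m → Ass k m} {b : Fin n → Ass k m}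
    (hb : ∀ i, b i [] = 0) (h : ∀ i, der v (b i) = 0) (f : Ass k n) : der v (subst b f) = 0 := by
  have := map_der (cts_subst hb) (subst_one hb) (subst_mul hb) (u := 0) (v := v)
    (fun i => by rw [der_zero, subst_x hb, h, LinearMap.zero_apply, map_zero]) f
  rw [← this, der_zero, LinearMap.zero_apply, map_zero]

theorem map_1_2_eq_cable (u : Fin 2 → Ass k 2) : map_1_2 u = cable ![some 0, some 1, none] u := by
  funext i
  fin_cases i <;> simp [map_1_2, cable, strands_1_2]

theorem map_2_3_eq_cable (u : Fin 2 → Ass k 2) : map_2_3 u = cable ![none, some 0, some 1] u := by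
  funext i
  fin_cases i <;> simp [map_2_3, cable, strands_2_3]

theorem map_12_3_eq_cable (u : Fin 2 → Ass k 2) : map_12_3 u = cable ![some 0, some 0, some 1] u := by
  funext i
  fin_cases i <;> simp [map_12_3, cable, strands_12_3]

theorem map_1_23_eq_cable (u : Fin 2 → Ass k 2) : map_1_23 u = cable ![some 0, some 1, some 1] u := by
  funext i
  fin_cases i <;> simp [map_1_23, cable, strands_1_23]

theorem subst_pair_x {q r : Ass k 3} (hq : q [] = 0) (hr : r [] = 0) :
    subst ![q, r] (x 0) = q ∧ subst ![q, r] (x 1) = r :=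
  ⟨subst_x (vec_nil hq hr) 0, subst_x (vec_nil hq hr) 1⟩

theorem map_1_2_t (c : k) : map_1_2 (c • t k) = ![c • x 1, c • x 0, 0] := by
  obtain ⟨h0, h1⟩ := subst_pair_x (k := k) (x_nil 0) (x_nil 1)
  funext i
  fin_cases i <;> simp [map_1_2, t, h0, h1]

theorem map_2_3_t (c : k) : map_2_3 (c • t k) = ![0, c • x 2, c • x 1] := by
  obtain ⟨h0, h1⟩ := subst_pair_x (k := k) (x_nil 1) (x_nil 2)
  funext i
  fin_cases i <;> simp [map_2_3, t, h0, h1]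

theorem map_12_3_t (c : k) : map_12_3 (c • t k) = ![c • x 2, c • x 2, c • (x 0 + x 1)] := by
  obtain ⟨h0, h1⟩ := subst_pair_x (k := k) (x_add_x_nil 0 1) (x_nil 2)
  funext i
  fin_cases i <;> simp [map_12_3, t, h0, h1]

theorem map_1_23_t (c : k) : map_1_23 (c • t k) = ![c • (x 1 + x 2), c • x 0, c • x 0] := by
  obtain ⟨h0, h1⟩ := subst_pair_x (k := k) (x_nil 0) (x_add_x_nil 1 2)
  funext i
  fin_cases i <;> simp [map_1_23, t, h0, h1]

variable [CharZero k]

variable (u : Fin 2 → Ass k 2)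

/-- The derivation `t^{1,2}` kills `x + y` and `z`, hence every entry of `u^{12,3}`. As `x` and `y`
are bracketed with the same entry there, `u^{12,3}` sends `[x, y]` to its bracket with that entry,
and the two orders agree. -/
theorem der_map_1_2_t_comm (c : k) :
    Commute (der (map_1_2 (c • t k))) (der (map_12_3 u)) := by
  set v := map_1_2 (c • t k) with hv
  have v0 : v 0 = c • x 1 := by rw [hv, map_1_2_t]; rfl
  have v1 : v 1 = c • x 0 := by rw [hv, map_1_2_t]; rfl
  have v2 : v 2 = 0 := by rw [hv, map_1_2_t]; rfl
  have hS : ∀ f, der v (subst ![x 0 + x 1, x 2] f) = 0 := by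
    refine der_subst_eq_zero (vec_nil (x_add_x_nil 0 1) (x_nil 2)) (Fin.forall_fin_two.2 ⟨?_, ?_⟩)
    · change der v (x 0 + x 1) = 0
      rw [map_add, der_x, der_x, v0, v1]
      simp
    · change der v (x 2) = 0
      rw [der_x, v2]; simp
  set w := map_12_3 u with hw
  have w1 : w 1 = w 0 := rfl
  have hw0 : der v (w 0) = 0 := hS _
  have hw2 : der v (w 2) = 0 := hS _
  have hx2 : der v (x 2) = 0 := by rw [der_x, v2]; simp
  refine der_comm fun i => ?_
  fin_cases i
  · change der v (der w (x 0)) = der w (der v (x 0))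
    simp only [der_x, v0, w1, map_sub, der_mul, hw0, map_smul]
    simp only [mul_smul_comm, smul_mul_assoc, mul_sub, sub_mul, smul_sub, mul_assoc,
      mul_zero, zero_mul]
    abel
  · change der v (der w (x 1)) = der w (der v (x 1))
    simp only [der_x, v1, w1, map_sub, der_mul, hw0, map_smul]
    simp only [mul_smul_comm, smul_mul_assoc, mul_sub, sub_mul, smul_sub, mul_assoc,
      mul_zero, zero_mul]
    abel
  · change der v (der w (x 2)) = der w (der v (x 2))
    rw [hx2, der_x, map_sub, der_mul, der_mul, hx2, hw2]
    simp

theorem der_map_2_3_t_comm (c : k) :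
    Commute (der (map_2_3 (c • t k))) (der (map_1_23 u)) := by
  set v := map_2_3 (c • t k) with hv
  have v0 : v 0 = 0 := by rw [hv, map_2_3_t]; rfl
  have v1 : v 1 = c • x 2 := by rw [hv, map_2_3_t]; rfl
  have v2 : v 2 = c • x 1 := by rw [hv, map_2_3_t]; rfl
  have hS : ∀ f, der v (subst ![x 0, x 1 + x 2] f) = 0 := by
    refine der_subst_eq_zero (vec_nil (x_nil 0) (x_add_x_nil 1 2)) (Fin.forall_fin_two.2 ⟨?_, ?_⟩)
    · change der v (x 0) = 0
      rw [der_x, v0]; simp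
    · change der v (x 1 + x 2) = 0
      rw [map_add, der_x, der_x, v1, v2]
      simp
  set w := map_1_23 u with hw
  have w1 : w 2 = w 1 := rfl
  have hw0 : der v (w 0) = 0 := hS _
  have hw2 : der v (w 1) = 0 := hS _
  have hx0 : der v (x 0) = 0 := by rw [der_x, v0]; simp
  refine der_comm fun i => ?_
  fin_cases i
  · change der v (der w (x 0)) = der w (der v (x 0))
    rw [hx0, der_x, map_sub, der_mul, der_mul, hx0, hw0]
    simp
  · change der v (der w (x 1)) = der w (der v (x 1))
    simp only [der_x, v1, w1, map_sub, der_mul, hw2, map_smul]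
    simp only [mul_smul_comm, smul_mul_assoc, mul_sub, sub_mul, smul_sub, mul_assoc,
      mul_zero, zero_mul]
    abel
  · change der v (der w (x 2)) = der w (der v (x 2))
    simp only [der_x, v2, w1, map_sub, der_mul, hw2, map_smul]
    simp only [mul_smul_comm, smul_mul_assoc, mul_sub, sub_mul, smul_sub, mul_assoc,
      mul_zero, zero_mul]
    abel

end Pentagon

/-! ### Invariance of `Φ` under `exp(c t)`, and centrality of `t` -/

section Main

variable {k : Type*} [Field k] [CharZero k]

theorem expAut_comm {n : ℕ} {u v : Fin n → Ass k n} (h : Commute (der u) (der v)) :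
    Commute (expAut u) (expAut v) :=
  LinearEquiv.ext fun f => LinearMap.congr_fun (opExp_comm (raises_der u) (raises_der v) h).eq f

theorem expAut_add {n : ℕ} {u v : Fin n → Ass k n} (h : Commute (der u) (der v)) :
    expAut (u + v) = expAut u * expAut v :=
  LinearEquiv.ext fun f => by
    rw [expAut_apply, der_add, opExp_add (raises_der u) (raises_der v) h]
    rfl

/-- The inner derivation `t^{1,2} + t^{12,3} = t^{2,3} + t^{1,23}`. -/
theorem expAut_t_mul (c : k) :
    expAut (map_1_2 (c • t k)) * expAut (map_12_3 (c • t k))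
        = expAut (fun i => c • (x 0 + x 1 + x 2) - c • x i) ∧
      expAut (map_2_3 (c • t k)) * expAut (map_1_23 (c • t k))
        = expAut (fun i => c • (x 0 + x 1 + x 2) - c • x i) := by
  rw [← expAut_add (der_map_1_2_t_comm _ c), ← expAut_add (der_map_2_3_t_comm _ c), map_1_2_t,
    map_12_3_t, map_2_3_t, map_1_23_t]
  constructor
  · congr 1
    funext i
    fin_cases i <;> simp [smul_add] <;> abel
  · congr 1
    funext i
    fin_cases i <;> simp [smul_add] <;> abel

theorem der_sum_sub (c : k) : der (fun i : Fin 3 => c • (x 0 + x 1 + x 2) - c • x i)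
    = LinearMap.mulRight k (c • (x 0 + x 1 + x 2))
      + LinearMap.mulLeft k (-(c • (x 0 + x 1 + x 2))) := by
  refine der_eq_inner fun i => ?_
  rw [mul_sub, sub_mul, mul_smul_comm c (x i) (x i), smul_mul_assoc c (x i) (x i)]
  abel

/-- `F^{1,2} F^{12,3}` sends `x + y + z` to `ch(ch(x, y), z)`, and `F^{2,3} F^{1,23}` sends it to
`ch(x, ch(y, z))`; these agree by associativity. -/
theorem pentagonSol_sum {u : Fin 2 → Ass k 2} (hu : expAut u (x 0 + x 1) = ch k) :
    pentagonSol u (x 0 + x 1 + x 2) = x 0 + x 1 + x 2 := by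
  have hch : ∀ b : Fin 2 → Ass k 3, subst b (ch k) [] = 0 := fun b => (subst_nil _).trans ch_nil
  have hA : expAut (map_12_3 u) (x 0 + x 1 + x 2) = subst ![x 0 + x 1, x 2] (ch k) := by
    have h := expAut_cable_subst ![some 0, some 0, some 1] u (x 0 + x 1)
    obtain ⟨h0, h1⟩ := subst_pair_x (k := k) (x_add_x_nil 0 1) (x_nil 2)
    rwa [← map_12_3_eq_cable, strands_12_3, hu, map_add, h0, h1] at h
  have hD : expAut (map_1_23 u) (x 0 + x 1 + x 2) = subst ![x 0, x 1 + x 2] (ch k) := by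
    have h := expAut_cable_subst ![some 0, some 1, some 1] u (x 0 + x 1)
    obtain ⟨h0, h1⟩ := subst_pair_x (k := k) (x_nil 0) (x_add_x_nil 1 2)
    rwa [← map_1_23_eq_cable, strands_1_23, hu, map_add, h0, h1, ← add_assoc] at h
  have hB : expAut (map_1_2 u) (x 0 + x 1) = subst ![x 0, x 1] (ch k) := by
    have h := expAut_cable_subst ![some 0, some 1, none] u (x 0 + x 1)
    obtain ⟨h0, h1⟩ := subst_pair_x (k := k) (x_nil 0) (x_nil 1)
    rwa [← map_1_2_eq_cable, strands_1_2, hu, map_add, h0, h1] at h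
  have hC : expAut (map_2_3 u) (x 1 + x 2) = subst ![x 1, x 2] (ch k) := by
    have h := expAut_cable_subst ![none, some 0, some 1] u (x 0 + x 1)
    obtain ⟨h0, h1⟩ := subst_pair_x (k := k) (x_nil 1) (x_nil 2)
    rwa [← map_2_3_eq_cable, strands_2_3, hu, map_add, h0, h1] at h
  have hB2 : expAut (map_1_2 u) (x 2) = x 2 :=
    expAut_of_der_eq_zero (by rw [der_x]; simp [map_1_2])
  have hC0 : expAut (map_2_3 u) (x 0) = x 0 :=
    expAut_of_der_eq_zero (by rw [der_x]; simp [map_2_3])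
  have hmap : ∀ (v : Fin 3 → Ass k 3) {q r : Ass k 3}, q [] = 0 → r [] = 0 →
      expAut v (subst ![q, r] (ch k)) = subst ![expAut v q, expAut v r] (ch k) := by
    intro v q r hq hr
    have h := map_subst (cts_expAut v) (expAut_one v) (expAut_mul v) (vec_nil hq hr)
      (fun i => (expAut_nil v _).trans (vec_nil hq hr i)) (ch k)
    rw [LinearEquiv.coe_coe] at h
    rw [h]
    congr 2
    funext i; fin_cases i <;> rfl
  apply (expAut (map_12_3 u)).injective
  apply (expAut (map_1_2 u)).injective
  rw [pentagonSol_spec, hA, hD, hmap _ (x_add_x_nil 0 1) (x_nil 2),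
    hmap _ (x_nil 0) (x_add_x_nil 1 2), hB, hB2, hC, hC0, ch_assoc (x_nil 0) (x_nil 1) (x_nil 2)]

theorem pentagonSol_apply (u : Fin 2 → Ass k 2) (f : Ass k 3) :
    pentagonSol u f = expAut (-map_12_3 u) (expAut (-map_1_2 u)
      (expAut (map_2_3 u) (expAut (map_1_23 u) f))) := rfl

theorem pentagonSol_mul (u : Fin 2 → Ass k 2) (f g : Ass k 3) :
    pentagonSol u (f * g) = pentagonSol u f * pentagonSol u g := by
  simp only [pentagonSol_apply, expAut_mul]

theorem cts_pentagonSol (u : Fin 2 → Ass k 2) :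
    Cts (pentagonSol u : Ass k 3 →ₗ[k] Ass k 3) := by
  refine cts_of_orderGE fun d f hf => ?_
  rw [LinearEquiv.coe_coe, pentagonSol_apply]
  have h : ∀ (v : Fin 3 → Ass k 3) {f : Ass k 3}, OrderGE d f → OrderGE d (expAut v f) :=
    fun v _ hf => (raises_der v).orderGE_opExp hf
  exact h _ (h _ (h _ (h _ hf)))

theorem pentagonSol_comm {u : Fin 2 → Ass k 2} (hu : expAut u (x 0 + x 1) = ch k) (c : k) :
    Commute (pentagonSol u) (expAut (fun i => c • (x 0 + x 1 + x 2) - c • x i)) := by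
  refine LinearEquiv.ext fun f => ?_
  refine map_opExp (cts_pentagonSol u) (raises_der _) (raises_der _) (fun f => ?_) f
  rw [der_sum_sub]
  simp only [LinearMap.add_apply, LinearMap.mulRight_apply, LinearMap.mulLeft_apply,
    LinearEquiv.coe_coe, map_add (pentagonSol u), pentagonSol_mul, map_neg (pentagonSol u),
    map_smul (pentagonSol u)]
  rw [← map_add, ← map_add, pentagonSol_sum hu]

theorem smul_t_mem_hkv (c : k) : c • t k ∈ hkv k := by
  refine ⟨smul_t_mem_dert c, ?_, ?_⟩
  · rw [der_smul_t, LinearMap.add_apply, LinearMap.mulRight_apply, LinearMap.mulLeft_apply,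
      mul_smul_comm, neg_mul, smul_mul_assoc, add_neg_cancel]
  · have h0 : partialD 0 ((c • t k) 0) = 0 := by
      ext w
      cases w <;> simp [partialD, t, x, word]
    have h1 : partialD 1 ((c • t k) 1) = 0 := by
      ext w
      cases w <;> simp [partialD, t, x, word]
    rw [div, divAss, Fin.sum_univ_two, h0, h1, mul_zero, mul_zero, add_zero, map_zero]
    exact Submodule.zero_mem _

/-- A derivation that kills `x + y` commutes with multiplication by it on either side. -/
theorem expAut_smul_t_comm {u : Fin 2 → Ass k 2} (hu : der u (x 0 + x 1) = 0) (c : k) :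
    Commute (expAut (c • t k)) (expAut u) := by
  refine expAut_comm (LinearMap.ext fun f => ?_)
  have hs : der u (c • (x 0 + x 1)) = 0 := by rw [map_smul, hu, smul_zero]
  rw [Module.End.mul_apply, Module.End.mul_apply, der_smul_t]
  generalize c • (x 0 + x 1 : Ass k 2) = s at hs
  simp [der_mul, hs]

/-- Conjugating by `X` changes nothing; write `X` as `T₂ T₁` on the left and `T₃ T₄` on the right,
then slide `T₂` past `A` and `T₃` past `D` to reach the factors they belong to. -/
theorem pentagon_group_identity {G : Type*} [Group G] {A B C D T₁ T₂ T₃ T₄ X : G}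
    (h₁ : T₂ * A = A * T₂) (h₂ : T₃ * D = D * T₃) (e₁ : T₂ * T₁ = X) (e₂ : T₃ * T₄ = X)
    (h : Commute (A⁻¹ * B⁻¹ * C * D) X) :
    A⁻¹ * B⁻¹ * C * D = (A * T₁)⁻¹ * (B * T₂)⁻¹ * (C * T₃) * (D * T₄) :=
  calc A⁻¹ * B⁻¹ * C * D = X⁻¹ * (A⁻¹ * B⁻¹ * C * D * X) := by rw [h.eq, inv_mul_cancel_left]
    _ = (T₂ * T₁)⁻¹ * (A⁻¹ * B⁻¹ * C * D * (T₃ * T₄)) := by rw [e₁, e₂]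
    _ = T₁⁻¹ * (A * T₂)⁻¹ * B⁻¹ * C * (D * T₃) * T₄ := by simp only [mul_inv_rev, mul_assoc]
    _ = T₁⁻¹ * (T₂ * A)⁻¹ * B⁻¹ * C * (T₃ * D) * T₄ := by rw [h₁, h₂]
    _ = _ := by simp only [mul_inv_rev, mul_assoc]

theorem pentagonSol_eq_of_eq_mul {u₁ u₂ : Fin 2 → Ass k 2} (h₁ : u₁ ∈ dert k 2)
    (h₂ : u₂ ∈ dert k 2) (hch : expAut u₁ (x 0 + x 1) = ch k) {c : k}
    (h : expAut u₂ = expAut u₁ * expAut (c • t k)) : pentagonSol u₁ = pentagonSol u₂ := by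
  have hcab := fun j : Fin 3 → Option (Fin 2) =>
    expAut_cable_mul j h₁ h₂ (smul_t_mem_dert c) h
  obtain ⟨e1, e2⟩ := expAut_t_mul c
  have hc : Commute ((expAut (map_12_3 u₁))⁻¹ * (expAut (map_1_2 u₁))⁻¹
    * expAut (map_2_3 u₁) * expAut (map_1_23 u₁)) _ := pentagonSol_comm hch c
  have c1 := (expAut_comm (der_map_1_2_t_comm u₁ c)).eq
  have c2 := (expAut_comm (der_map_2_3_t_comm u₁ c)).eq
  change _ = (expAut (map_12_3 u₂))⁻¹ * (expAut (map_1_2 u₂))⁻¹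
    * expAut (map_2_3 u₂) * expAut (map_1_23 u₂)
  rw [map_12_3_eq_cable u₂, map_1_2_eq_cable u₂, map_2_3_eq_cable u₂, map_1_23_eq_cable u₂, hcab,
    hcab, hcab, hcab]
  simp only [← map_12_3_eq_cable, ← map_1_2_eq_cable, ← map_2_3_eq_cable, ← map_1_23_eq_cable]
  exact pentagon_group_identity c1 c2 e1 e2 hc

end Main

end Ass

theorem mainTheorem12 {k : Type*} [Field k] [CharZero k] :
    (∀ u₁ ∈ Ass.SolHKV k, ∀ u₂ ∈ Ass.SolHKV k,
      (Ass.pentagonSol u₁ = Ass.pentagonSol u₂ ↔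
        ∃ c : k, Ass.expAut u₂ = Ass.expAut u₁ * Ass.expAut (c • Ass.t k))) ∧
    (∀ c : k, c • Ass.t k ∈ Ass.hkv k ∧
      ∀ u ∈ Ass.hkv k, Commute (Ass.expAut (c • Ass.t k)) (Ass.expAut u)) := by
  refine ⟨fun u₁ h₁ u₂ h₂ => ⟨fun h => ?_, ?_⟩, fun c => ⟨Ass.smul_t_mem_hkv c, fun u hu =>
    Ass.expAut_smul_t_comm hu.2.1 c⟩⟩
  · exact Ass.eq_mul_expAut_t_of_pentagonSol_eq h₁.1 h₂.1 (h₁.2.1.trans h₂.2.1.symm) h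
  · rintro ⟨c, h⟩
    exact Ass.pentagonSol_eq_of_eq_mul h₁.1 h₂.1 h₁.2.1 h
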